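/- An assigned one-dimensional crease pattern is a horizontal line segment of positive length (the paper) together with a finite set of $n\ge 0$ interior points (the creases), each labelled mountain or valley. The creases and the two ends of the paper are its vertices, $v_0<v_1<\dots<v_{n+1}$; a segment is the piece of paper between consecutive vertices. A flat folding of the pattern maps the paper to a line, continuously and isometrically on each segment, reversing direction at every crease, and stacks the overlapping layers in an order without crossings such that every crease is bent in its assigned orientation. A simple fold of $k\ge 1$ layers starts from a placement of the paper on the line in stacked layers. It folds the top $k$ or the bottom $k$ layers at a point $x$, each of them at a not yet folded crease and in the orientation assigned to that crease, by rotating by $180^\circ$ around $x$ (over the top or under the bottom of the stack, respectively) the part of the paper that lies beyond these creases, which must lie on one side of $x$ and must not meet any unmoved paper during the rotation. In the some-layers model $k\ge1$ is arbitrary; in the one-layer model $k=1$. A segment between two creases is crimpable if it is no longer than either neighbouring segment and its two endpoints have opposite labels; a crimp folds both creases, and its result is the crease pattern in which the segment and its two neighbours, of lengths $b$ and $a,c$, are replaced by one segment of length $a-b+c$. A segment at an end of the paper is end-foldable if it has a neighbouring segment and is no longer than it; an end fold folds the crease between them, and its result is the crease pattern with the end segment deleted. Let $f$ be the continuous map of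 the paper to the line that keeps the first segment fixed and maps successive segments isometrically, alternately to the right and to the left. For creases $P<Q$, with $X$ the vertex just before $P$ and $Y$ the vertex just after $Q$, the interval $[P,Q]$ is suspicious if $f(X)\notin f([P,Q])$ and $f(Y)\notin f([P,Q])$. It is innocent if the numbers of mountain creases and of valley creases in $[P,Q]$, including $P$ and $Q$, differ by at most $1$. Theorem. For every assigned one-dimensional crease pattern the following are equivalent: (1) all creases can be folded by a finite sequence of crimps and end folds, each applied to the result of the preceding one; (2) starting from the unfolded paper, all creases can be folded by a finite sequence of one-layer simple folds; (3) starting from the unfolded paper, all creases can be folded by a finite sequence of some-layers simple folds; (4) the crease pattern has a flat folding; (5) every suspicious interval is innocent. -/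

import Mathlib

/-- The two orientations that an assigned crease can have. -/
inductive Orientation1D where
  | mountain
  | valley
  deriving DecidableEq

/-- An assigned one-dimensional crease pattern with `n` creases.  The paper is the segment from
`vertex 0` to `vertex (Fin.last (n + 1))`; the vertices in between are the creases.
Crease `j : Fin n` is the vertex `j.castSucc.succ`, and segment `i : Fin (n + 1)` is the piece of
paper between the consecutive vertices `i.castSucc` and `i.succ`.  Thus crease `j` joins the
segments `j.castSucc` and `j.succ`. -/
structure CreasePattern (n : ℕ) where
  vertex : Fin (n + 2) → ℝ
  strictMono : StrictMono vertex
  label : Fin n → Orientation1D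

namespace CreasePattern

variable {n : ℕ}

/-- The length of a segment. -/
def len (P : CreasePattern n) (i : Fin (n + 1)) : ℝ := P.vertex i.succ - P.vertex i.castSucc

/-! ### Suspicious and innocent intervals -/

/-- The horizontal position of a vertex in the folded state: the first segment remains stationary
and the successive segments go alternately right and left. -/
def foldedPos (P : CreasePattern n) (v : Fin (n + 2)) : ℝ :=
  P.vertex 0 + ∑ i : Fin (n + 1), if i.castSucc < v then (-1) ^ (i : ℕ) * P.len i else 0

/-- The image, in the folded state, of the interval of paper between the creases `p` and `q`: the
union of the images of its segments. -/
def intervalImage (P : CreasePattern n) (p q : Fin n) : Set ℝ :=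
  ⋃ i ∈ Set.Icc p.succ q.castSucc, Set.uIcc (P.foldedPos i.castSucc) (P.foldedPos i.succ)

/-- The interior interval between the creases `p < q` is suspicious if the far endpoints of both its
flaps are mapped outside the image of the interval. -/
def Suspicious (P : CreasePattern n) (p q : Fin n) : Prop :=
  p < q ∧
  P.foldedPos p.castSucc.castSucc ∉ P.intervalImage p q ∧
  P.foldedPos q.succ.succ ∉ P.intervalImage p q

/-- The numbers of mountain and valley creases in the interval from crease `p` to crease `q`, both
included, differ by at most one. -/
def Innocent (P : CreasePattern n) (p q : Fin n) : Prop :=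
  |(((Finset.Icc p q).filter fun j => P.label j = Orientation1D.mountain).card : ℤ) -
    (((Finset.Icc p q).filter fun j => P.label j = Orientation1D.valley).card : ℤ)| ≤ 1

/-! ### Crimps and end folds -/

/-- The segment between the consecutive creases `k` and `k + 1` is crimpable: it is no longer than
either of its flaps, and the two creases have opposite orientations. -/
def Crimpable (P : CreasePattern (n + 2)) (k : Fin (n + 1)) : Prop :=
  P.len k.succ.castSucc ≤ P.len k.castSucc.castSucc ∧
  P.len k.succ.castSucc ≤ P.len k.succ.succ ∧
  P.label k.castSucc ≠ P.label k.succ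

/-- The result of a crimp: the two creases are folded and disappear, the three segments around them
become one, and the paper on the right moves left by twice the length of the crimped segment. -/
def crimp (P : CreasePattern (n + 2)) (k : Fin (n + 1)) (h : P.Crimpable k) :
    CreasePattern n where
  vertex i := if (i : ℕ) ≤ k then P.vertex (i.castAdd 2)
    else P.vertex (i.addNat 2) - 2 * P.len k.succ.castSucc
  strictMono := by
    have hP := P.strictMono
    rw [Fin.strictMono_iff_lt_succ]
    intro i
    simp only [Fin.val_castSucc, Fin.val_succ]
    by_cases h1 : (i : ℕ) + 1 ≤ k
    · rw [if_pos (by omega), if_pos h1]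
      apply hP
      simp [Fin.lt_def]
    · by_cases h2 : (i : ℕ) ≤ k
      · rw [if_pos h2, if_neg h1]
        have hik : i = k := Fin.ext (by omega)
        subst hik
        obtain ⟨ha, hb, -⟩ := h
        have hc : P.vertex i.succ.castSucc.castSucc < P.vertex i.succ.succ.castSucc := by
          apply hP
          simp [Fin.lt_def]
        simp only [len] at ha hb ⊢
        have e1 : (i.castSucc.castAdd 2 : Fin (n + 2 + 2)) = i.castSucc.castSucc.castSucc := rfl
        have e2 : (i.succ.addNat 2 : Fin (n + 2 + 2)) = i.succ.succ.succ := rfl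
        have e3 : (i.castSucc.castSucc.succ : Fin (n + 2 + 2)) = i.succ.castSucc.castSucc := rfl
        have e4 : (i.succ.castSucc.succ : Fin (n + 2 + 2)) = i.succ.succ.castSucc := rfl
        rw [e1, e2]
        rw [e3, e4] at ha
        rw [e4] at hb ⊢
        linarith
      · rw [if_neg h2, if_neg h1]
        have : P.vertex (i.castSucc.addNat 2) < P.vertex (i.succ.addNat 2) := by
          apply hP
          simp [Fin.lt_def]
        linarith
  label j := if (j : ℕ) < k then P.label (j.castAdd 2) else P.label (j.addNat 2)

/-- The first segment is no longer than its flap. -/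
def LeftEndFoldable (P : CreasePattern (n + 1)) : Prop := P.len 0 ≤ P.len 1

/-- The result of folding the first crease: the first segment is deleted. -/
def leftEndFold (P : CreasePattern (n + 1)) : CreasePattern n where
  vertex i := P.vertex i.succ
  strictMono := P.strictMono.comp Fin.strictMono_succ
  label j := P.label j.succ

/-- The last segment is no longer than its flap. -/
def RightEndFoldable (P : CreasePattern (n + 1)) : Prop :=
  P.len (Fin.last (n + 1)) ≤ P.len (Fin.last n).castSucc

/-- The result of folding the last crease: the last segment is deleted. -/
def rightEndFold (P : CreasePattern (n + 1)) : CreasePattern n where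
  vertex i := P.vertex i.castSucc
  strictMono := P.strictMono.comp Fin.strictMono_castSucc
  label j := P.label j.castSucc

/-- A sequence of crimps and end folds, each applied to the result of the preceding operation, folds
all creases. -/
inductive FoldableByCrimpsAndEndFolds : ∀ {n : ℕ}, CreasePattern n → Prop
  | done (P : CreasePattern 0) : FoldableByCrimpsAndEndFolds P
  | crimp {n : ℕ} (P : CreasePattern (n + 2)) (k : Fin (n + 1)) (h : P.Crimpable k) :
      FoldableByCrimpsAndEndFolds (P.crimp k h) → FoldableByCrimpsAndEndFolds P
  | leftEnd {n : ℕ} (P : CreasePattern (n + 1)) (h : P.LeftEndFoldable) :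
      FoldableByCrimpsAndEndFolds P.leftEndFold → FoldableByCrimpsAndEndFolds P
  | rightEnd {n : ℕ} (P : CreasePattern (n + 1)) (h : P.RightEndFoldable) :
      FoldableByCrimpsAndEndFolds P.rightEndFold → FoldableByCrimpsAndEndFolds P

/-! ### Placements of the paper on a line, in layers -/

/-- A placement of the paper on the line: a continuous map, isometric on every segment, given by the
positions of the vertices, together with the heights of the segments in the stack of layers.
A greater height means a higher layer; only the order of the heights of overlapping segments is
relevant.  Whether the layers avoid crossing each other is not part of this structure. -/
structure Placement (P : CreasePattern n) where
  pos : Fin (n + 2) → ℝ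
  isometry : ∀ i : Fin (n + 1), |pos i.succ - pos i.castSucc| = P.len i
  layer : Fin (n + 1) → ℤ

namespace Placement

variable {P : CreasePattern n}

/-- The position of a crease. -/
def creasePos (s : P.Placement) (j : Fin n) : ℝ := s.pos j.castSucc.succ

/-- The interior of the image of a segment. -/
def interiorImage (s : P.Placement) (i : Fin (n + 1)) : Set ℝ :=
  Set.Ioo (min (s.pos i.castSucc) (s.pos i.succ)) (max (s.pos i.castSucc) (s.pos i.succ))

/-- The images of two segments share more than an endpoint, so that one lies above the other. -/
def Overlap (s : P.Placement) (i k : Fin (n + 1)) : Prop :=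
  (s.interiorImage i ∩ s.interiorImage k).Nonempty

/-- A segment that runs from left to right has its original top side up; a segment that runs from
right to left has been turned over. -/
def FaceUp (s : P.Placement) (i : Fin (n + 1)) : Prop := s.pos i.castSucc < s.pos i.succ

/-- The paper reverses its direction at the crease. -/
def Folded (s : P.Placement) (j : Fin n) : Prop := ¬ (s.FaceUp j.castSucc ↔ s.FaceUp j.succ)

/-- The layer after the crease lies on the original top side of the layer before it. -/
def IsValley (s : P.Placement) (j : Fin n) : Prop :=
  (s.FaceUp j.castSucc ∧ s.layer j.castSucc < s.layer j.succ) ∨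
  (¬ s.FaceUp j.castSucc ∧ s.layer j.succ < s.layer j.castSucc)

/-- The layer after the crease lies on the original bottom side of the layer before it. -/
def IsMountain (s : P.Placement) (j : Fin n) : Prop :=
  (s.FaceUp j.castSucc ∧ s.layer j.succ < s.layer j.castSucc) ∨
  (¬ s.FaceUp j.castSucc ∧ s.layer j.castSucc < s.layer j.succ)

/-- The crease is bent in its assigned orientation. -/
def Respects (s : P.Placement) (j : Fin n) : Prop :=
  match P.label j with
  | Orientation1D.valley => s.IsValley j
  | Orientation1D.mountain => s.IsMountain j

/-- Segment `k` lies strictly between the two layers that crease `j` joins. -/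
def Between (s : P.Placement) (j : Fin n) (k : Fin (n + 1)) : Prop :=
  min (s.layer j.castSucc) (s.layer j.succ) < s.layer k ∧
  s.layer k < max (s.layer j.castSucc) (s.layer j.succ)

/-- A flat folding of an assigned crease pattern: all creases are folded, in their assigned
orientations, and the layers do not cross. -/
structure IsFlatFolding (s : P.Placement) : Prop where
  folded : ∀ j, s.Folded j
  respects : ∀ j, s.Respects j
  /-- overlapping segments are stacked in some order -/
  layered : ∀ i k, i ≠ k → s.Overlap i k → s.layer i ≠ s.layer k
  /-- no segment passes through a crease -/
  not_through : ∀ j k, s.creasePos j ∈ s.interiorImage k → ¬ s.Between j k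
  /-- two creases at the same place, open to the same side, are nested or apart -/
  not_interleaved : ∀ j j', s.creasePos j = s.creasePos j' → s.Overlap j.castSucc j'.castSucc →
    (s.Between j j'.castSucc ↔ s.Between j j'.succ)

/-- The initial placement of the unfolded paper. -/
def unfolded (P : CreasePattern n) : P.Placement where
  pos := P.vertex
  isometry i := abs_of_pos (sub_pos.mpr (P.strictMono i.castSucc_lt_succ))
  layer _ := 0

/-- The creases that separate the moved segments (those in `M`) from the others. -/
def hinges (M : Set (Fin (n + 1))) : Set (Fin n) := {j | Xor (j.castSucc ∈ M) (j.succ ∈ M)}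

/-- A simple fold at the point `x` of the line, from the placement `s` to the placement `t`: the
segments in `M`, all of them on one side of `x`, are rotated around `x` by 180 degrees, either over
the top or under the bottom. -/
structure IsFoldAt (s t : P.Placement) (x : ℝ) (M : Set (Fin (n + 1))) : Prop where
  /-- the moved and the unmoved paper are joined only by unfolded creases at `x`, -/
  hinge_pos : ∀ j ∈ hinges M, s.creasePos j = x ∧ ¬ s.Folded j
  /-- which get folded in their assigned orientations -/
  hinge_respects : ∀ j ∈ hinges M, t.Respects j
  one_side : (∀ i ∈ M, x ≤ s.pos i.castSucc ∧ x ≤ s.pos i.succ) ∨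
    (∀ i ∈ M, s.pos i.castSucc ≤ x ∧ s.pos i.succ ≤ x)
  pos_moved : ∀ i ∈ M, t.pos i.castSucc = 2 * x - s.pos i.castSucc ∧
    t.pos i.succ = 2 * x - s.pos i.succ
  pos_unmoved : ∀ i ∉ M, t.pos i.castSucc = s.pos i.castSucc ∧ t.pos i.succ = s.pos i.succ
  /-- the rotation reverses the order of the moved layers -/
  layer_moved : ∃ c : ℤ, ∀ i ∈ M, t.layer i = c - s.layer i
  layer_unmoved : ∀ i ∉ M, t.layer i = s.layer i
  /-- the moved layers are on top of the stack before and after, or at its bottom before and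
  after -/
  outermost :
    ((∀ i ∈ M, ∀ k ∉ M, s.Overlap i k → s.layer k < s.layer i) ∧
      (∀ i ∈ M, ∀ k ∉ M, t.layer k < t.layer i)) ∨
    ((∀ i ∈ M, ∀ k ∉ M, s.Overlap i k → s.layer i < s.layer k) ∧
      (∀ i ∈ M, ∀ k ∉ M, t.layer i < t.layer k))

/-- A simple fold of exactly `k` layers (the top `k` or the bottom `k` layers at the place of the
fold). -/
def IsSimpleFold (k : ℕ) (s t : P.Placement) : Prop :=
  ∃ (x : ℝ) (M : Set (Fin (n + 1))), s.IsFoldAt t x M ∧ (hinges M).ncard = k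

/-- The one-layer model: a single layer is folded. -/
def OneLayerFold (s t : P.Placement) : Prop := s.IsSimpleFold 1 t

/-- The some-layers model: any positive number of layers is folded. -/
def SomeLayersFold (s t : P.Placement) : Prop := ∃ k, 1 ≤ k ∧ s.IsSimpleFold k t

end Placement

/-- A finite sequence of one-layer simple folds, starting with the unfolded paper, folds all
creases. -/
def FoldableByOneLayerFolds (P : CreasePattern n) : Prop :=
  ∃ s : P.Placement, Relation.ReflTransGen Placement.OneLayerFold (Placement.unfolded P) s ∧
    ∀ j, s.Folded j

/-- A finite sequence of some-layers simple folds, starting with the unfolded paper, folds all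
creases. -/
def FoldableBySomeLayersFolds (P : CreasePattern n) : Prop :=
  ∃ s : P.Placement, Relation.ReflTransGen Placement.SomeLayersFold (Placement.unfolded P) s ∧
    ∀ j, s.Folded j

/-- The crease pattern has a flat folding. -/
def FlatFoldable (P : CreasePattern n) : Prop := ∃ s : P.Placement, s.IsFlatFolding

end CreasePattern

/-! The five conditions are linked in a cycle. A one-layer fold is a some-layers fold; the other
four arrows need arguments.

From a flat folding to innocence: this is a discrete form of Hopf's argument for the turning number.
A suspicious interval with its two flaps becomes a zigzag that does not cross itself. The direction
from segment `i` to segment `k` is up, down, left or right, and its quarter turns add up to the same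
number along all paths in the triangle `i ≤ k`, since non-crossing makes them cancel around each
small square (`LayeredZigzag.flat`). Along the diagonal the sum is twice the total turn, that is,
twice the difference of valleys and mountains. Along the two legs it is at most two in absolute
value, because the far ends of the flaps lie outside the range of the turning points
(`LayeredZigzag.abs_sum_turnSign_le`).

From innocence to crimps and end folds: induction on the number of creases. If no end can be folded,
a maximal run of shortest segments has strictly longer flaps, so it spans a suspicious interval;
innocence then forbids equal labels throughout, and two adjacent opposite labels give a crimp
(`exists_crimpable`). Innocence survives because every suspicious interval of the result comes from
one of the original with the same difference of labels (`exists_interval_of_crimp` for crimps).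

From crimps and end folds to one-layer folds: an end fold is one simple fold of flat paper, a crimp
is two. Afterwards bundles of segments move like single segments of the smaller pattern, so a
folding sequence of that pattern lifts fold by fold (`Simulates.exists_oneLayerFold`).

From some-layers folds to a flat folding: non-crossing, stated for partially folded paper as
`IsPartialFolding`, is preserved by every simple fold (`IsFoldAt.isPartialFolding`). -/

namespace CreasePattern

/-! ### The turning number of a layered zigzag -/

/-- Path independence on a triangular grid. -/
theorem sum_legs_eq_sum_diagonal (h : ℕ → ℕ → ℤ) (m : ℕ)
    (flat : ∀ i k, i < k → k < m → h i k + h (k + 1) i = h k i + h (i + 1) k) :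
    ∑ k ∈ Finset.range m, h 0 k + ∑ i ∈ Finset.range m, h m i =
      ∑ j ∈ Finset.range m, (h j j + h (j + 1) j) := by
  induction m with
  | zero => simp
  | succ m ih =>
    have ih := ih fun i k h1 h2 => flat i k h1 (by omega)
    -- Adding one column of squares: by flatness the increments telescope along the column.
    have e : ∑ i ∈ Finset.range m, (h (m + 1) i - h m i) = h m m - h 0 m := by
      rw [← Finset.sum_range_sub (fun i => h i m)]
      refine Finset.sum_congr rfl fun i hi => ?_
      have := flat i m (Finset.mem_range.1 hi) (by omega)
      linarith
    rw [Finset.sum_sub_distrib] at e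
    rw [Finset.sum_range_succ, Finset.sum_range_succ, Finset.sum_range_succ, ← ih]
    linarith

/-- A zigzag of `m + 1` segments, segment `i` running from `x i` to `x (i + 1)` in layer `l i`,
that does not cross itself. -/
structure LayeredZigzag (x : ℕ → ℝ) (l : ℕ → ℤ) (m : ℕ) : Prop where
  turn : ∀ i < m, (x i < x (i + 1) ∧ x (i + 2) < x (i + 1)) ∨
    (x (i + 1) < x i ∧ x (i + 1) < x (i + 2))
  layered : ∀ i ≤ m, ∀ k ≤ m, i ≠ k → min (x i) (x (i + 1)) < max (x k) (x (k + 1)) →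
    min (x k) (x (k + 1)) < max (x i) (x (i + 1)) → l i ≠ l k
  not_through : ∀ j < m, ∀ k ≤ m, min (x k) (x (k + 1)) < x (j + 1) →
    x (j + 1) < max (x k) (x (k + 1)) →
    ¬ (min (l j) (l (j + 1)) < l k ∧ l k < max (l j) (l (j + 1)))
  not_interleaved : ∀ i < m, ∀ k < m, x (i + 1) = x (k + 1) →
    min (x i) (x (i + 1)) < max (x k) (x (k + 1)) →
    min (x k) (x (k + 1)) < max (x i) (x (i + 1)) →
    ((min (l i) (l (i + 1)) < l k ∧ l k < max (l i) (l (i + 1))) ↔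
      (min (l i) (l (i + 1)) < l (k + 1) ∧ l (k + 1) < max (l i) (l (i + 1))))

open Classical in
/-- The side, above or below, on which segment `k` lies of segment `i`, if they overlap. -/
noncomputable def relHeight (x : ℕ → ℝ) (l : ℕ → ℤ) (i k : ℕ) : ℤ :=
  if min (x i) (x (i + 1)) < max (x k) (x (k + 1)) ∧ min (x k) (x (k + 1)) < max (x i) (x (i + 1))
  then (l k - l i).sign else 0

open Classical in
/-- The number of quarter turns made by the direction from segment `i` to segment `k` when `k` is
replaced by `k + 1`. -/
noncomputable def quarterTurns (x : ℕ → ℝ) (l : ℕ → ℤ) (i k : ℕ) : ℤ :=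
  (if x i + x (i + 1) ≤ 2 * x (k + 1) then 1 else -1) *
    (relHeight x l i (k + 1) - relHeight x l i k)

section
variable {x : ℕ → ℝ} {l : ℕ → ℤ} {m : ℕ}

theorem relHeight_self (i : ℕ) : relHeight x l i i = 0 := by simp [relHeight]

theorem relHeight_swap (i k : ℕ) : relHeight x l k i = - relHeight x l i k := by
  unfold relHeight
  rw [← neg_sub (l k) (l i), Int.sign_neg]
  by_cases h : min (x i) (x (i + 1)) < max (x k) (x (k + 1)) ∧
      min (x k) (x (k + 1)) < max (x i) (x (i + 1))
  · rw [if_pos h, if_pos h.symm]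
  · rw [if_neg h, if_neg fun h' => h h'.symm, neg_zero]

theorem abs_relHeight_le (i k : ℕ) : |relHeight x l i k| ≤ 1 := by
  unfold relHeight
  split_ifs
  · rcases Int.sign_trichotomy (l k - l i) with h | h | h <;> simp [h]
  · simp

theorem sign_sub_eq_sign_sub {a b c : ℤ} (ha : a ≠ c) (hb : b ≠ c)
    (h : ¬ (min a b < c ∧ c < max a b)) : (a - c).sign = (b - c).sign := by
  rcases lt_or_gt_of_ne ha with h1 | h1 <;> rcases lt_or_gt_of_ne hb with h2 | h2
  · rw [Int.sign_eq_neg_one_of_neg (by omega), Int.sign_eq_neg_one_of_neg (by omega)]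
  · omega
  · omega
  · rw [Int.sign_eq_one_of_pos (by omega), Int.sign_eq_one_of_pos (by omega)]

/-- A crease strictly inside the span of segment `i` cannot wrap around that segment, so both layers
that meet there are on the same side of it. -/
theorem LayeredZigzag.relHeight_eq_of_through (H : LayeredZigzag x l m) {i k : ℕ} (hi : i ≤ m)
    (hk : k < m) (h1 : min (x i) (x (i + 1)) < x (k + 1))
    (h2 : x (k + 1) < max (x i) (x (i + 1))) :
    relHeight x l i k = relHeight x l i (k + 1) := by
  have hik : i ≠ k := by
    rintro rfl
    rcases le_total (x i) (x (i + 1)) with h | h <;> simp_all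
  have hik' : i ≠ k + 1 := by
    rintro rfl
    rcases le_total (x (k + 1)) (x (k + 1 + 1)) with h | h <;> simp_all
  have a1 : min (x i) (x (i + 1)) < max (x k) (x (k + 1)) := h1.trans_le (le_max_right _ _)
  have a2 : min (x k) (x (k + 1)) < max (x i) (x (i + 1)) := (min_le_right _ _).trans_lt h2
  have b1 : min (x i) (x (i + 1)) < max (x (k + 1)) (x (k + 1 + 1)) :=
    h1.trans_le (le_max_left _ _)
  have b2 : min (x (k + 1)) (x (k + 1 + 1)) < max (x i) (x (i + 1)) :=
    (min_le_left _ _).trans_lt h2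
  unfold relHeight
  rw [if_pos ⟨a1, a2⟩, if_pos ⟨b1, b2⟩]
  exact sign_sub_eq_sign_sub (H.layered i hi k hk.le hik a1 a2).symm
    (H.layered i hi (k + 1) hk hik' b1 b2).symm (H.not_through k hk i hi h1 h2)

/-- The midpoint in the sign convention is arbitrary: inside the span of segment `i` the height
difference vanishes, so knowing the position of the turning point relative to one end of the span is
enough to fix the sign. -/
theorem LayeredZigzag.quarterTurns_of_lt (H : LayeredZigzag x l m) {i k : ℕ} (hi : i ≤ m)
    (hk : k < m) (h : min (x i) (x (i + 1)) < x (k + 1)) :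
    quarterTurns x l i k = relHeight x l i (k + 1) - relHeight x l i k := by
  unfold quarterTurns
  by_cases h2 : x (k + 1) < max (x i) (x (i + 1))
  · rw [H.relHeight_eq_of_through hi hk h h2]; simp
  · rw [if_pos, one_mul]
    rw [not_lt, max_le_iff] at h2
    linarith

theorem LayeredZigzag.quarterTurns_of_gt (H : LayeredZigzag x l m) {i k : ℕ} (hi : i ≤ m)
    (hk : k < m) (h : x (k + 1) < max (x i) (x (i + 1))) :
    quarterTurns x l i k = -(relHeight x l i (k + 1) - relHeight x l i k) := by
  unfold quarterTurns
  by_cases h2 : min (x i) (x (i + 1)) < x (k + 1)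
  · rw [H.relHeight_eq_of_through hi hk h2 h]; simp
  · rw [if_neg, neg_one_mul]
    rw [not_lt, le_min_iff] at h2
    rcases lt_max_iff.1 h with h | h <;> linarith

theorem relHeight_of_separated {i k : ℕ} {c : ℝ} (h1 : x i ≤ c) (h2 : x (i + 1) ≤ c)
    (h3 : c ≤ x k) (h4 : c ≤ x (k + 1)) : relHeight x l i k = 0 := by
  unfold relHeight
  rw [if_neg]
  rintro ⟨-, h⟩
  exact (((le_min h3 h4).trans_lt h).trans_le (max_le h1 h2)).false

/-- If `c` and `d` both lie between `a` and `b`, each side of the equation is a cancelling pair;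
otherwise `a` and `b` see `c` on the same side, and likewise `d`. -/
theorem sign_sub_add_sign_sub_of_nested_or_apart {a b c d : ℤ} (h1 : a ≠ c) (h2 : a ≠ d)
    (h3 : b ≠ c) (h4 : b ≠ d)
    (h5 : (min a b < c ∧ c < max a b) ↔ (min a b < d ∧ d < max a b)) :
    (c - a).sign + (d - b).sign = (d - a).sign + (c - b).sign := by
  by_cases h7 : min a b < c ∧ c < max a b
  · have h8 := h5.1 h7
    rcases le_total a b with h9 | h9
    · rw [Int.sign_eq_one_of_pos (by omega), Int.sign_eq_one_of_pos (a := d - a) (by omega),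
        Int.sign_eq_neg_one_of_neg (by omega), Int.sign_eq_neg_one_of_neg (by omega)]
    · rw [Int.sign_eq_one_of_pos (a := d - b) (by omega),
        Int.sign_eq_one_of_pos (a := c - b) (by omega),
        Int.sign_eq_neg_one_of_neg (by omega), Int.sign_eq_neg_one_of_neg (by omega)]
  · have h8 := mt h5.2 h7
    have e1 : (c - a).sign = (c - b).sign := by
      rw [← neg_sub a c, ← neg_sub b c, Int.sign_neg, Int.sign_neg, sign_sub_eq_sign_sub h1 h3 h7]
    have e2 : (d - a).sign = (d - b).sign := by
      rw [← neg_sub a d, ← neg_sub b d, Int.sign_neg, Int.sign_neg, sign_sub_eq_sign_sub h2 h4 h8]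
    rw [e1, e2, add_comm]

/-- Two creases at the same place open either to opposite sides, and then the segments are apart and
all terms vanish, or to the same side, and then all four pairs overlap and non-interleaving gives
the identity. -/
theorem LayeredZigzag.flat_of_eq (H : LayeredZigzag x l m) {i k : ℕ} (hik : i + 1 ≤ k)
    (hk : k < m) (h : x (i + 1) = x (k + 1)) :
    quarterTurns x l i k + quarterTurns x l (k + 1) i =
      quarterTurns x l k i + quarterTurns x l (i + 1) k := by
  have hik' : i + 1 ≠ k := by
    rintro rfl
    rcases H.turn i (by omega) with h' | h' <;> linarith
  have e : x (i + 1 + 1) = x (i + 2) := rfl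
  have e' : x (k + 1 + 1) = x (k + 2) := rfl
  have apart : (∀ i' k', (i' = i ∨ i' = i + 1) → (k' = k ∨ k' = k + 1) →
      relHeight x l i' k' = 0) → quarterTurns x l i k + quarterTurns x l (k + 1) i =
      quarterTurns x l k i + quarterTurns x l (i + 1) k := by
    intro z
    simp [quarterTurns, relHeight_swap i, relHeight_swap (i + 1), z]
  have together : (∀ i' k', (i' = i ∨ i' = i + 1) → (k' = k ∨ k' = k + 1) →
      min (x i') (x (i' + 1)) < max (x k') (x (k' + 1)) ∧
      min (x k') (x (k' + 1)) < max (x i') (x (i' + 1))) →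
      relHeight x l i k + relHeight x l (i + 1) (k + 1) =
        relHeight x l i (k + 1) + relHeight x l (i + 1) k := by
    intro z
    have ne := fun i' k' hi' hk' => H.layered i' (by omega) k' (by omega) (by omega)
      (z i' k' hi' hk').1 (z i' k' hi' hk').2
    have r : ∀ i' k', (i' = i ∨ i' = i + 1) → (k' = k ∨ k' = k + 1) →
        relHeight x l i' k' = (l k' - l i').sign := fun i' k' hi' hk' => if_pos (z i' k' hi' hk')
    rw [r _ _ (.inl rfl) (.inl rfl), r _ _ (.inl rfl) (.inr rfl), r _ _ (.inr rfl) (.inl rfl),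
      r _ _ (.inr rfl) (.inr rfl)]
    have z := z i k (.inl rfl) (.inl rfl)
    exact sign_sub_add_sign_sub_of_nested_or_apart
      (ne _ _ (.inl rfl) (.inl rfl)) (ne _ _ (.inl rfl) (.inr rfl)) (ne _ _ (.inr rfl) (.inl rfl))
      (ne _ _ (.inr rfl) (.inr rfl)) (H.not_interleaved i (by omega) k hk h z.1 z.2)
  rcases H.turn i (by omega) with ⟨p1, p2⟩ | ⟨p1, p2⟩ <;>
    rcases H.turn k hk with ⟨q1, q2⟩ | ⟨q1, q2⟩
  · have B : ∀ i', (i' = i ∨ i' = i + 1) →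
        min (x i') (x (i' + 1)) < x (i + 1) ∧ x (i + 1) ≤ max (x i') (x (i' + 1)) := by
      rintro i' (rfl | rfl)
      exacts [⟨min_lt_of_left_lt p1, le_max_right _ _⟩, ⟨min_lt_of_right_lt p2, le_max_left _ _⟩]
    have B' : ∀ i', (i' = k ∨ i' = k + 1) →
        min (x i') (x (i' + 1)) < x (i + 1) ∧ x (i + 1) ≤ max (x i') (x (i' + 1)) := by
      rintro i' (rfl | rfl)
      exacts [⟨min_lt_of_left_lt (q1.trans_eq h.symm), h.le.trans (le_max_right _ _)⟩,
        ⟨min_lt_of_right_lt (q2.trans_eq h.symm), h.le.trans (le_max_left _ _)⟩]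
    have t := together fun i' k' hi' hk' =>
      ⟨(B i' hi').1.trans_le (B' k' hk').2, (B' k' hk').1.trans_le (B i' hi').2⟩
    have r1 : ∀ i' k', (i' = i ∨ i' = i + 1) → k' = k → quarterTurns x l i' k' =
        (relHeight x l i' (k' + 1) - relHeight x l i' k') := by
      rintro i' k' (rfl | rfl) rfl <;> rw [quarterTurns, if_pos (by linarith), one_mul]
    have r2 : ∀ i' k', (i' = k ∨ i' = k + 1) → k' = i → quarterTurns x l i' k' =
        (relHeight x l i' (k' + 1) - relHeight x l i' k') := by
      rintro i' k' (rfl | rfl) rfl <;> rw [quarterTurns, if_pos (by linarith), one_mul]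
    rw [r1 i k (.inl rfl) rfl, r1 (i + 1) k (.inr rfl) rfl, r2 k i (.inl rfl) rfl,
      r2 (k + 1) i (.inr rfl) rfl, relHeight_swap i k, relHeight_swap i (k + 1),
      relHeight_swap (i + 1) k, relHeight_swap (i + 1) (k + 1)]
    linarith
  · apply apart
    intro i' k' hi' hk'
    apply relHeight_of_separated (c := x (i + 1)) <;> rcases hi' with rfl | rfl <;>
      rcases hk' with rfl | rfl <;> linarith
  · apply apart
    intro i' k' hi' hk'
    rw [relHeight_swap, neg_eq_zero]
    apply relHeight_of_separated (c := x (i + 1)) <;> rcases hi' with rfl | rfl <;>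
      rcases hk' with rfl | rfl <;> linarith
  · have B : ∀ i', (i' = i ∨ i' = i + 1) →
        min (x i') (x (i' + 1)) ≤ x (i + 1) ∧ x (i + 1) < max (x i') (x (i' + 1)) := by
      rintro i' (rfl | rfl)
      exacts [⟨min_le_right _ _, lt_max_of_lt_left p1⟩, ⟨min_le_left _ _, lt_max_of_lt_right p2⟩]
    have B' : ∀ i', (i' = k ∨ i' = k + 1) →
        min (x i') (x (i' + 1)) ≤ x (i + 1) ∧ x (i + 1) < max (x i') (x (i' + 1)) := by
      rintro i' (rfl | rfl)
      exacts [⟨(min_le_right _ _).trans h.ge, lt_max_of_lt_left (h.trans_lt q1)⟩,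
        ⟨(min_le_left _ _).trans h.ge, lt_max_of_lt_right (h.trans_lt q2)⟩]
    have t := together fun i' k' hi' hk' =>
      ⟨(B i' hi').1.trans_lt (B' k' hk').2, (B' k' hk').1.trans_lt (B i' hi').2⟩
    have r1 : ∀ i' k', (i' = i ∨ i' = i + 1) → k' = k → quarterTurns x l i' k' =
        -(relHeight x l i' (k' + 1) - relHeight x l i' k') := by
      rintro i' k' (rfl | rfl) rfl <;> rw [quarterTurns, if_neg (by linarith), neg_one_mul]
    have r2 : ∀ i' k', (i' = k ∨ i' = k + 1) → k' = i → quarterTurns x l i' k' =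
        -(relHeight x l i' (k' + 1) - relHeight x l i' k') := by
      rintro i' k' (rfl | rfl) rfl <;> rw [quarterTurns, if_neg (by linarith), neg_one_mul]
    rw [r1 i k (.inl rfl) rfl, r1 (i + 1) k (.inr rfl) rfl, r2 k i (.inl rfl) rfl,
      r2 (k + 1) i (.inr rfl) rfl, relHeight_swap i k, relHeight_swap i (k + 1),
      relHeight_swap (i + 1) k, relHeight_swap (i + 1) (k + 1)]
    linarith

/-- If the turning points differ, their order fixes the sign of all four quarter turns, and the
antisymmetry of `relHeight` cancels everything. Nesting is needed only when they coincide. -/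
theorem LayeredZigzag.flat (H : LayeredZigzag x l m) {i k : ℕ} (hik : i < k) (hk : k < m) :
    quarterTurns x l i k + quarterTurns x l (k + 1) i =
      quarterTurns x l k i + quarterTurns x l (i + 1) k := by
  rcases lt_trichotomy (x (i + 1)) (x (k + 1)) with h | h | h
  · rw [H.quarterTurns_of_lt (by omega) hk (min_lt_of_right_lt h),
      H.quarterTurns_of_lt (by omega) hk (min_lt_of_left_lt h),
      H.quarterTurns_of_gt (by omega) (by omega) (lt_max_of_lt_right h),
      H.quarterTurns_of_gt (by omega) (by omega) (lt_max_of_lt_left h),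
      relHeight_swap i k, relHeight_swap i (k + 1),
      relHeight_swap (i + 1) k, relHeight_swap (i + 1) (k + 1)]
    ring
  · exact H.flat_of_eq hik hk h
  · rw [H.quarterTurns_of_gt (by omega) hk (lt_max_of_lt_right h),
      H.quarterTurns_of_gt (by omega) hk (lt_max_of_lt_left h),
      H.quarterTurns_of_lt (by omega) (by omega) (min_lt_of_right_lt h),
      H.quarterTurns_of_lt (by omega) (by omega) (min_lt_of_left_lt h),
      relHeight_swap i k, relHeight_swap i (k + 1),
      relHeight_swap (i + 1) k, relHeight_swap (i + 1) (k + 1)]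
    ring

/-- The set of values `f a, ..., f b` lies on one side of `y`. -/
def Avoids (f : ℕ → ℝ) (a b : ℕ) (y : ℝ) : Prop :=
  (∀ v, a ≤ v → v ≤ b → f v < y) ∨ (∀ v, a ≤ v → v ≤ b → y < f v)

/-- The turn at the end of segment `j`: half a turn to the left is `1`, to the right `-1`. -/
noncomputable def turnSign (x : ℕ → ℝ) (l : ℕ → ℤ) (j : ℕ) : ℤ :=
  (if x j < x (j + 1) then 1 else -1) * (l (j + 1) - l j).sign

/-- The relative height is zero at both ends of a diagonal step, so by antisymmetry the two quarter
turns are equal and together make the half turn at the crease. -/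
theorem LayeredZigzag.quarterTurns_diagonal (H : LayeredZigzag x l m) {j : ℕ} (hj : j < m) :
    quarterTurns x l j j + quarterTurns x l (j + 1) j = 2 * turnSign x l j := by
  have e : x (j + 1 + 1) = x (j + 2) := rfl
  have r : relHeight x l j (j + 1) = (l (j + 1) - l j).sign := by
    apply if_pos
    rcases H.turn j hj with ⟨h1, h2⟩ | ⟨h1, h2⟩
    · exact ⟨lt_max_of_lt_left (min_lt_of_left_lt h1), lt_max_of_lt_right (min_lt_of_right_lt h2)⟩
    · exact ⟨lt_max_of_lt_right (min_lt_of_right_lt h2), lt_max_of_lt_left (min_lt_of_left_lt h1)⟩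
  unfold quarterTurns turnSign
  rw [relHeight_self, relHeight_self, relHeight_swap j (j + 1), r]
  rcases H.turn j hj with ⟨h1, h2⟩ | ⟨h1, h2⟩
  · rw [if_pos (by linarith), if_pos (by linarith), if_pos h1]; ring
  · rw [if_neg (by linarith), if_neg (by linarith), if_neg h1.not_gt]; ring

/-- A form of Hopf's theorem on the turning number: if both ends of a layered zigzag lie outside
the range of its turning points, then it makes at most half a turn altogether. -/
theorem LayeredZigzag.abs_sum_turnSign_le (H : LayeredZigzag x l m) (h0 : Avoids x 1 m (x 0))
    (h1 : Avoids x 1 m (x (m + 1))) : |∑ j ∈ Finset.range m, turnSign x l j| ≤ 1 := by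
  have key := sum_legs_eq_sum_diagonal (quarterTurns x l) m fun i k hik hk => H.flat hik hk
  rw [Finset.sum_congr rfl fun j hj => H.quarterTurns_diagonal (Finset.mem_range.1 hj),
    ← Finset.mul_sum] at key
  -- An end of segment `i` with all turning points on one side of it gives all quarter turns of this
  -- leg the same sign, so their sum telescopes.
  have legs : ∀ i ≤ m, ∀ v, (v = i ∨ v = i + 1) → Avoids x 1 m (x v) →
      ∑ k ∈ Finset.range m, quarterTurns x l i k = relHeight x l i m - relHeight x l i 0 ∨
      ∑ k ∈ Finset.range m, quarterTurns x l i k = -(relHeight x l i m - relHeight x l i 0) := by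
    intro i hi v hv hav
    rw [← Finset.sum_range_sub (fun k => relHeight x l i k), ← Finset.sum_neg_distrib]
    rcases hav with hav | hav
    · refine .inr (Finset.sum_congr rfl fun k hk => ?_)
      rw [Finset.mem_range] at hk
      refine H.quarterTurns_of_gt hi hk ((hav (k + 1) (by omega) hk).trans_le ?_)
      rcases hv with rfl | rfl
      exacts [le_max_left _ _, le_max_right _ _]
    · refine .inl (Finset.sum_congr rfl fun k hk => ?_)
      rw [Finset.mem_range] at hk
      refine H.quarterTurns_of_lt hi hk (LE.le.trans_lt ?_ (hav (k + 1) (by omega) hk))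
      rcases hv with rfl | rfl
      exacts [min_le_left _ _, min_le_right _ _]
  have b := abs_le.1 (abs_relHeight_le (x := x) (l := l) 0 m)
  -- Each leg contributes the relative height of the two extreme segments up to sign, so twice the
  -- total turn is at most two in absolute value.
  have l0 := legs 0 (by omega) 0 (.inl rfl) h0
  have lm := legs m le_rfl (m + 1) (.inr rfl) h1
  rw [relHeight_self] at l0 lm
  rw [relHeight_swap 0 m] at lm
  rw [abs_le]
  omega

end
end CreasePattern

namespace CreasePattern

/-! ### Indexing by natural numbers -/

/-- Extension of a finite sequence to all natural numbers by a default value. -/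
def natExt {N : ℕ} {α : Type*} [Inhabited α] (f : Fin N → α) (m : ℕ) : α :=
  if h : m < N then f ⟨m, h⟩ else default

theorem natExt_of_lt {N : ℕ} {α : Type*} [Inhabited α] (f : Fin N → α) {m : ℕ} (h : m < N) :
    natExt f m = f ⟨m, h⟩ := dif_pos h

theorem natExt_val {N : ℕ} {α : Type*} [Inhabited α] (f : Fin N → α) (i : Fin N) :
    natExt f i = f i := natExt_of_lt f i.2

/-- The number of half turns to the left at a crease. -/
def turnOf : Orientation1D → ℤ
  | .mountain => -1
  | .valley => 1

variable {n : ℕ}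

theorem len_pos (P : CreasePattern n) (i : Fin (n + 1)) : 0 < P.len i :=
  sub_pos.2 (P.strictMono i.castSucc_lt_succ)

theorem foldedPos_succ (P : CreasePattern n) (i : Fin (n + 1)) :
    P.foldedPos i.succ = P.foldedPos i.castSucc + (-1) ^ (i : ℕ) * P.len i := by
  unfold foldedPos
  refine (congrArg (P.vertex 0 + ·) ?_).trans (add_assoc _ _ _).symm
  have : ∀ k : Fin (n + 1), (if k.castSucc < i.succ then (-1) ^ (k : ℕ) * P.len k else 0) =
      (if k.castSucc < i.castSucc then (-1) ^ (k : ℕ) * P.len k else 0) +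
      (if k = i then (-1) ^ (k : ℕ) * P.len k else 0) := by
    intro k
    rcases lt_trichotomy k i with h | rfl | h
    · rw [if_pos (Fin.castSucc_lt_succ_iff.2 h.le), if_pos (by simpa using h), if_neg h.ne,
        add_zero]
    · simp
    · rw [if_neg (by simpa using h), if_neg (by simpa using h.le), if_neg h.ne',
        add_zero]
  rw [Finset.sum_congr rfl fun k _ => this k, Finset.sum_add_distrib]
  simp

/-- The length of segment `m`. -/
noncomputable def segLen (P : CreasePattern n) : ℕ → ℝ := natExt P.len

/-- The folded position of vertex `m`. -/
noncomputable def fpos (P : CreasePattern n) : ℕ → ℝ := natExt P.foldedPos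

/-- The half turns to the left at crease `j`. -/
def creaseTurn (P : CreasePattern n) : ℕ → ℤ := natExt fun j => turnOf (P.label j)

theorem segLen_pos (P : CreasePattern n) {m : ℕ} (h : m ≤ n) : 0 < P.segLen m := by
  rw [segLen, natExt_of_lt _ (by omega)]
  exact P.len_pos _

theorem fpos_succ (P : CreasePattern n) {m : ℕ} (h : m ≤ n) :
    P.fpos (m + 1) = P.fpos m + (-1) ^ m * P.segLen m := by
  rw [fpos, natExt_of_lt _ (by omega), natExt_of_lt _ (by omega), segLen, natExt_of_lt _ (by omega)]
  exact P.foldedPos_succ ⟨m, by omega⟩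

theorem fpos_zero (P : CreasePattern n) : P.fpos 0 = P.vertex 0 := by
  rw [fpos, natExt_of_lt _ (by omega)]
  simp [foldedPos]

/-- A discrete intermediate value argument: the values can pass from one side of `y` to the other
only along a segment whose image contains `y`. -/
theorem avoids_iff (f : ℕ → ℝ) {a b : ℕ} (hab : a < b) (y : ℝ) :
    (∀ i, a ≤ i → i < b → y ∉ Set.uIcc (f i) (f (i + 1))) ↔ Avoids f a b y := by
  constructor
  · intro H
    rcases lt_trichotomy (f a) y with h | h | h
    · refine .inl fun v hv => ?_
      induction v, hv using Nat.le_induction with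
      | base => exact fun _ => h
      | succ v hv ih =>
        intro hb
        by_contra hc
        exact H v hv (by omega) (Set.mem_uIcc.2 (.inl ⟨(ih (by omega)).le, not_lt.1 hc⟩))
    · exact absurd (h ▸ Set.left_mem_uIcc) (H a le_rfl hab)
    · refine .inr fun v hv => ?_
      induction v, hv using Nat.le_induction with
      | base => exact fun _ => h
      | succ v hv ih =>
        intro hb
        by_contra hc
        exact H v hv (by omega) (Set.mem_uIcc.2 (.inr ⟨not_lt.1 hc, (ih (by omega)).le⟩))
  · rintro (H | H) i hi hb h
    · have h1 := H i hi hb.le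
      have h2 := H (i + 1) (by omega) hb
      rcases Set.mem_uIcc.1 h with h | h <;> linarith
    · have h1 := H i hi hb.le
      have h2 := H (i + 1) (by omega) hb
      rcases Set.mem_uIcc.1 h with h | h <;> linarith

theorem notMem_intervalImage_iff (P : CreasePattern n) {p q : Fin n} (hpq : p < q) (y : ℝ) :
    y ∉ P.intervalImage p q ↔ Avoids P.fpos (p + 1) (q + 1) y := by
  rw [← avoids_iff _ (by simpa using hpq)]
  simp only [intervalImage, Set.mem_iUnion, not_exists, Set.mem_Icc]
  constructor
  · intro H i h1 h2
    have := q.2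
    have := H ⟨i, by omega⟩ ⟨by simp [Fin.le_def]; omega, by simp [Fin.le_def]; omega⟩
    rwa [fpos, natExt_of_lt _ (by omega), natExt_of_lt _ (by omega)]
  · rintro H i ⟨h1, h2⟩
    simp only [Fin.le_def, Fin.val_succ, Fin.val_castSucc] at h1 h2
    have := H i h1 (by omega)
    rwa [fpos, natExt_of_lt _ (by omega), natExt_of_lt _ (by omega)] at this

theorem suspicious_iff (P : CreasePattern n) (p q : Fin n) :
    P.Suspicious p q ↔ p < q ∧ Avoids P.fpos (p + 1) (q + 1) (P.fpos p) ∧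
      Avoids P.fpos (p + 1) (q + 1) (P.fpos (q + 2)) := by
  unfold Suspicious
  refine and_congr_right fun h => ?_
  rw [P.notMem_intervalImage_iff h, P.notMem_intervalImage_iff h, fpos,
    natExt_of_lt _ (m := p) (by omega), natExt_of_lt _ (m := q + 2) (by omega)]
  rfl

theorem innocent_iff (P : CreasePattern n) (p q : Fin n) :
    P.Innocent p q ↔ |∑ j ∈ Finset.Icc (p : ℕ) q, P.creaseTurn j| ≤ 1 := by
  unfold Innocent
  rw [abs_sub_comm, ← Fin.map_valEmbedding_Icc, Finset.sum_map, Finset.card_filter,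
    Finset.card_filter, Nat.cast_sum, Nat.cast_sum, ← Finset.sum_sub_distrib]
  refine Eq.to_iff (congrArg (fun z : ℤ => |z| ≤ 1) (Finset.sum_congr rfl fun j _ => ?_))
  rw [Fin.valEmbedding_apply, creaseTurn, natExt_val]
  cases P.label j <;> simp [turnOf]

/-! ### Flat-foldable patterns have only innocent suspicious intervals -/

namespace Placement

variable {P : CreasePattern n}

theorem pos_ne (s : P.Placement) (i : Fin (n + 1)) : s.pos i.castSucc ≠ s.pos i.succ := fun h => by
  have := s.isometry i
  rw [h, sub_self, abs_zero] at this
  exact (P.len_pos i).ne this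

theorem overlap_iff (s : P.Placement) (i k : Fin (n + 1)) : s.Overlap i k ↔
    min (s.pos i.castSucc) (s.pos i.succ) < max (s.pos k.castSucc) (s.pos k.succ) ∧
    min (s.pos k.castSucc) (s.pos k.succ) < max (s.pos i.castSucc) (s.pos i.succ) := by
  have hi := min_lt_max.2 (s.pos_ne i)
  have hk := min_lt_max.2 (s.pos_ne k)
  unfold Overlap interiorImage
  rw [Set.Ioo_inter_Ioo, Set.nonempty_Ioo, max_lt_iff, lt_min_iff, lt_min_iff]
  tauto

theorem folded_iff (s : P.Placement) (j : Fin n) : s.Folded j ↔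
    (s.pos j.castSucc.castSucc < s.pos j.castSucc.succ ∧ s.pos j.succ.succ < s.pos j.castSucc.succ) ∨
    (s.pos j.castSucc.succ < s.pos j.castSucc.castSucc ∧
      s.pos j.castSucc.succ < s.pos j.succ.succ) := by
  have h1 := s.pos_ne j.castSucc
  have h2 := s.pos_ne j.succ
  unfold Folded FaceUp
  rw [show j.succ.castSucc = j.castSucc.succ from rfl] at *
  rcases lt_or_gt_of_ne h1 with h1 | h1 <;> rcases lt_or_gt_of_ne h2 with h2 | h2 <;>
    simp [h1, h2, h1.not_gt, h2.not_gt]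

/-- A completely folded placement is congruent to the standard one. -/
theorem exists_pos_eq (s : P.Placement) (h : ∀ j, s.Folded j) : ∃ ε c : ℝ, (ε = 1 ∨ ε = -1) ∧
    ∀ v < n + 2, natExt s.pos v = ε * P.fpos v + c := by
  have iso : ∀ m ≤ n, |natExt s.pos (m + 1) - natExt s.pos m| = P.segLen m := by
    intro m hm
    rw [natExt_of_lt _ (by omega), natExt_of_lt _ (by omega), segLen, natExt_of_lt _ (by omega)]
    exact s.isometry ⟨m, by omega⟩
  have turn : ∀ j < n, (natExt s.pos j < natExt s.pos (j + 1) ∧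
      natExt s.pos (j + 2) < natExt s.pos (j + 1)) ∨ (natExt s.pos (j + 1) < natExt s.pos j ∧
      natExt s.pos (j + 1) < natExt s.pos (j + 2)) := by
    intro j hj
    rw [natExt_of_lt _ (by omega), natExt_of_lt _ (by omega), natExt_of_lt _ (by omega)]
    exact (s.folded_iff ⟨j, hj⟩).1 (h _)
  -- Every crease reverses the direction, so the direction of the first segment determines all the
  -- others.
  have step : ∃ ε : ℝ, (ε = 1 ∨ ε = -1) ∧ ∀ m ≤ n,
      natExt s.pos (m + 1) - natExt s.pos m = ε * ((-1) ^ m * P.segLen m) := by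
    have : ∃ ε : ℝ, (ε = 1 ∨ ε = -1) ∧
        natExt s.pos (0 + 1) - natExt s.pos 0 = ε * ((-1) ^ 0 * P.segLen 0) := by
      rcases eq_or_eq_neg_of_abs_eq (iso 0 (by omega)) with h | h
      · exact ⟨1, .inl rfl, by rw [h]; ring⟩
      · exact ⟨-1, .inr rfl, by rw [h]; ring⟩
    obtain ⟨ε, hε, h0⟩ := this
    refine ⟨ε, hε, fun m => ?_⟩
    induction m with
    | zero => exact fun _ => h0
    | succ m ih =>
      intro hm
      have ih := ih (by omega)
      have p1 := P.segLen_pos (m := m) (by omega)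
      have p2 := P.segLen_pos hm
      have t := turn m (by omega)
      rw [pow_succ]
      have e : m + 1 + 1 = m + 2 := rfl
      rcases eq_or_eq_neg_of_abs_eq (iso (m + 1) hm) with h | h <;> rw [h] <;> rw [e] at h <;>
        rcases hε with rfl | rfl <;> rcases neg_one_pow_eq_or ℝ m with h' | h' <;> rw [h'] at ih ⊢ <;>
        rcases t with t | t <;> linarith
  obtain ⟨ε, hε, hs⟩ := step
  refine ⟨ε, natExt s.pos 0 - ε * P.fpos 0, hε, fun v => ?_⟩
  induction v with
  | zero => intro _; ring
  | succ v ih =>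
    intro hv
    have ih := ih (by omega)
    have := hs v (by omega)
    rw [P.fpos_succ (by omega)]
    linarith

theorem IsFlatFolding.layeredZigzag {s : P.Placement} (hs : s.IsFlatFolding) {p m : ℕ}
    (h : p + m ≤ n) :
    LayeredZigzag (fun t => natExt s.pos (p + t)) (fun t => natExt s.layer (p + t)) m := by
  have L : ∀ i (hi : i ≤ m), natExt s.layer (p + i) = s.layer ⟨p + i, by omega⟩ := fun i hi =>
    natExt_of_lt _ _
  have X : ∀ i (hi : i ≤ m + 1), natExt s.pos (p + i) = s.pos ⟨p + i, by omega⟩ := fun i hi =>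
    natExt_of_lt _ _
  constructor
  · intro i hi
    rw [X i (by omega), X (i + 1) (by omega), X (i + 2) (by omega)]
    exact (s.folded_iff ⟨p + i, by omega⟩).1 (hs.folded _)
  · intro i hi k hk ne
    rw [X i (by omega), X (i + 1) (by omega), X k (by omega), X (k + 1) (by omega), L i hi, L k hk]
    intro h1 h2
    exact hs.layered _ _ (by simpa [Fin.ext_iff] using ne) ((s.overlap_iff _ _).2 ⟨h1, h2⟩)
  · intro j hj k hk
    rw [X (j + 1) (by omega), X k (by omega), X (k + 1) (by omega), L j (by omega),
      L (j + 1) (by omega), L k hk]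
    intro h1 h2
    exact hs.not_through ⟨p + j, by omega⟩ ⟨p + k, by omega⟩ ⟨h1, h2⟩
  · intro i hi k hk
    rw [X i (by omega), X (i + 1) (by omega), X k (by omega), X (k + 1) (by omega),
      L i (by omega), L (i + 1) (by omega), L k (by omega), L (k + 1) (by omega)]
    intro h0 h1 h2
    exact hs.not_interleaved ⟨p + i, by omega⟩ ⟨p + k, by omega⟩ h0
      ((s.overlap_iff _ _).2 ⟨h1, h2⟩)

theorem Respects.turnSign_eq {s : P.Placement} {j : Fin n} (h : s.Respects j) :
    turnSign (natExt s.pos) (natExt s.layer) j = P.creaseTurn j := by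
  rw [turnSign, natExt_of_lt _ (m := j) (by omega), natExt_of_lt _ (m := (j : ℕ)) (by omega),
    natExt_of_lt _ (m := j + 1) (by omega), natExt_of_lt _ (m := (j : ℕ) + 1) (by omega),
    creaseTurn, natExt_val]
  change (if s.pos j.castSucc.castSucc < s.pos j.castSucc.succ then 1 else -1) *
    (s.layer j.succ - s.layer j.castSucc).sign = turnOf (P.label j)
  unfold Respects IsValley IsMountain FaceUp at h
  split at h <;> rename_i e <;> rw [e] <;> rcases h with ⟨h1, h2⟩ | ⟨h1, h2⟩ <;>
    simp only [h1, if_true, if_false, turnOf]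
  · rw [Int.sign_eq_one_of_pos (by omega)]; rfl
  · rw [Int.sign_eq_neg_one_of_neg (by omega)]; rfl
  · rw [Int.sign_eq_neg_one_of_neg (by omega)]; rfl
  · rw [Int.sign_eq_one_of_pos (by omega)]; rfl

end Placement

/-- The zigzag consists of the interval and its flaps, segments `p` to `q + 1`, so it has `m = q + 1
- p` turns. Suspicion says precisely that its two ends avoid the range of its turning points. -/
theorem FlatFoldable.innocent {P : CreasePattern n} (h : P.FlatFoldable) {p q : Fin n}
    (hpq : P.Suspicious p q) : P.Innocent p q := by
  obtain ⟨s, hs⟩ := h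
  obtain ⟨hlt, hX, hY⟩ := (P.suspicious_iff p q).1 hpq
  obtain ⟨ε, c, hε, hpos⟩ := s.exists_pos_eq hs.folded
  rw [Fin.lt_def] at hlt
  have hq := q.2
  obtain ⟨m, hm⟩ : ∃ m, (q : ℕ) + 1 = p + m := ⟨q + 1 - p, by omega⟩
  have av : ∀ y < n + 2, Avoids P.fpos (p + 1) (q + 1) (P.fpos y) →
      Avoids (fun t => natExt s.pos (p + t)) 1 m (natExt s.pos y) := by
    intro y hy h
    rcases hε with rfl | rfl <;> rcases h with h | h
    · refine .inl fun v h1 h2 => ?_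
      have := h (p + v) (by omega) (by omega)
      simp only [hpos _ hy, hpos (p + v) (by omega)]
      linarith
    · refine .inr fun v h1 h2 => ?_
      have := h (p + v) (by omega) (by omega)
      simp only [hpos _ hy, hpos (p + v) (by omega)]
      linarith
    · refine .inr fun v h1 h2 => ?_
      have := h (p + v) (by omega) (by omega)
      simp only [hpos _ hy, hpos (p + v) (by omega)]
      linarith
    · refine .inl fun v h1 h2 => ?_
      have := h (p + v) (by omega) (by omega)
      simp only [hpos _ hy, hpos (p + v) (by omega)]
      linarith
  have key := (hs.layeredZigzag (p := p) (m := m) (by omega)).abs_sum_turnSign_le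
    (av p (by omega) hX) (by
      rw [show (p : ℕ) + (m + 1) = q + 2 by omega]
      exact av _ (by omega) hY)
  rw [innocent_iff]
  convert key using 2
  rw [show Finset.Icc (p : ℕ) q = Finset.Ico (p : ℕ) (p + m) by ext; simp; omega,
    Finset.sum_Ico_eq_sum_range, Nat.add_sub_cancel_left]
  refine Finset.sum_congr rfl fun j hj => ?_
  rw [Finset.mem_range] at hj
  exact ((hs.respects ⟨p + j, by omega⟩).turnSign_eq).symm

end CreasePattern

namespace CreasePattern

/-! ### Innocence is inherited by crimps and end folds -/

theorem Avoids.neg {f : ℕ → ℝ} {a b : ℕ} {y : ℝ} (h : Avoids f a b y) : Avoids (-f) a b (-y) :=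
  h.symm.imp (fun h v h1 h2 => neg_lt_neg (h v h1 h2)) fun h v h1 h2 => neg_lt_neg (h v h1 h2)

/-- In the zigzag `f` two turns are undone between the vertices `k` and `k + 3`, and the result is
`f'`; the partial sums of the turns are `G` and `G'`.  Then an interval of `f'` with avoiding flaps
comes from such an interval of `f`. -/
theorem exists_interval_of_crimp_of_le {f f' : ℕ → ℝ} {G G' : ℕ → ℤ} {k N : ℕ}
    (h1 : ∀ m ≤ k, f' m = f m) (h2 : ∀ m, k < m → m ≤ N → f' m = f (m + 2))
    (g1 : ∀ m ≤ k, G' m = G m) (g2 : ∀ m, k ≤ m → G' m = G (m + 2))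
    (z1 : f k ≤ f (k + 2)) (z2 : f (k + 2) ≤ f (k + 1)) (z3 : f (k + 1) ≤ f (k + 3))
    {p q : ℕ} (hpq : p < q) (hq : q + 2 ≤ N) (hX : Avoids f' (p + 1) (q + 1) (f' p))
    (hY : Avoids f' (p + 1) (q + 1) (f' (q + 2))) :
    ∃ p₂ q₂, p₂ < q₂ ∧ q₂ ≤ q + 2 ∧ Avoids f (p₂ + 1) (q₂ + 1) (f p₂) ∧
      Avoids f (p₂ + 1) (q₂ + 1) (f (q₂ + 2)) ∧ G (q₂ + 1) - G p₂ = G' (q + 1) - G' p := by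
  have shift : ∀ y, k ≤ p → Avoids f' (p + 1) (q + 1) y → Avoids f (p + 3) (q + 3) y := by
    intro y hp h
    have e : ∀ v, p + 3 ≤ v → v ≤ q + 3 → f v = f' (v - 2) := fun v a b => by
      rw [h2 _ (by omega) (by omega), Nat.sub_add_cancel (by omega)]
    exact h.imp (fun h v a b => e v a b ▸ h _ (by omega) (by omega))
      fun h v a b => e v a b ▸ h _ (by omega) (by omega)
  have same : ∀ y, q + 1 ≤ k → Avoids f' (p + 1) (q + 1) y → Avoids f (p + 1) (q + 1) y := by
    intro y hp h
    exact h.imp (fun h v a b => h1 v (by omega) ▸ h v a b) fun h v a b => h1 v (by omega) ▸ h v a b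
  rcases lt_trichotomy p k with hp | rfl | hp
  · rcases lt_trichotomy (q + 1) k with hq' | hq' | hq'
    · rw [h1 _ hp.le] at hX
      rw [h1 _ (by omega)] at hY
      exact ⟨p, q, hpq, by omega, same _ hq'.le hX, same _ hq'.le hY, by
        rw [g1 _ hq'.le, g1 _ hp.le]⟩
    · subst hq'
      rw [h1 _ hp.le] at hX
      rw [h2 _ (by omega) (by omega)] at hY
      have hX := same _ le_rfl hX
      have hY := same _ le_rfl hY
      have hY : ∀ v, p + 1 ≤ v → v ≤ q + 1 → f v < f (q + 4) := by
        rcases hY with h | h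
        · exact h
        · have : f (q + 4) < f (q + 1) := h (q + 1) (by omega) le_rfl
          have : f (q + 1) ≤ f (q + 4) := z1.trans (z2.trans z3)
          linarith
      -- The right flap is the merged segment. If its first piece already ends above the interval,
      -- the same interval works before the crimp. Otherwise the interval is extended over the two
      -- crimped creases: their vertices add no new extremes, and their turns cancel.
      by_cases hc : ∀ v, p + 1 ≤ v → v ≤ q + 1 → f v < f (q + 2)
      · exact ⟨p, q, hpq, by omega, hX, .inl hc, by rw [g1 _ le_rfl, g1 _ hp.le]⟩
      · push Not at hc
        obtain ⟨w, w1, w2, w3⟩ := hc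
        have split : ∀ v, p + 1 ≤ v → v ≤ q + 3 → v ≤ q + 1 ∨ v = q + 2 ∨ v = q + 3 := by omega
        refine ⟨p, q + 2, by omega, le_rfl, ?_, .inl ?_, by rw [g2 (q + 1) le_rfl, g1 _ hp.le]⟩
        · rcases hX with hX | hX
          · refine .inl fun v a b => ?_
            have := hX w w1 w2
            rcases split v a b with b | rfl | rfl
            · exact hX v a b
            · linarith
            · change f (q + 1 + 2) < _
              change f (q + 1 + 1) ≤ f w at w3
              linarith
          · refine .inr fun v a b => ?_
            have := hX (q + 1) (by omega) le_rfl
            rcases split v a b with b | rfl | rfl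
            · exact hX v a b
            · change _ < f (q + 1 + 1)
              linarith
            · change _ < f (q + 1 + 2)
              linarith
        · intro v a b
          have := hY w w1 w2
          change f (q + 1 + 1) ≤ f w at w3
          change f w < f (q + 1 + 3) at this
          change f v < f (q + 1 + 3)
          rcases split v a b with b | rfl | rfl
          · exact hY v a b
          · change f (q + 1 + 1) < _
            linarith
          · change f (q + 1 + 2) < _
            linarith
    -- The merged segment is inside the interval, and the two restored vertices have values between
    -- those of its ends.
    · have ext : ∀ y, Avoids f' (p + 1) (q + 1) y → Avoids f (p + 1) (q + 3) y := by
        intro y h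
        have split : ∀ v, p + 1 ≤ v → v ≤ q + 3 → f v = f' v ∧ v ≤ q + 1 ∨ v = k + 1 ∨ v = k + 2 ∨
            f v = f' (v - 2) ∧ p + 1 ≤ v - 2 := by
          intro v a b
          by_cases c1 : v ≤ k
          · exact .inl ⟨(h1 v c1).symm, by omega⟩
          by_cases c2 : k + 3 ≤ v
          · refine .inr (.inr (.inr ⟨?_, by omega⟩))
            rw [h2 _ (by omega) (by omega), Nat.sub_add_cancel (by omega)]
          · omega
        have e1 := h1 k le_rfl
        have e2 : f' (k + 1) = f (k + 3) := h2 (k + 1) (by omega) (by omega)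
        refine h.imp (fun h v a b => ?_) fun h v a b => ?_ <;>
        · have b1 := h k (by omega) (by omega)
          have b2 := h (k + 1) (by omega) (by omega)
          rcases split v a b with ⟨e, b'⟩ | rfl | rfl | ⟨e, b'⟩
          · rw [e]; exact h _ a b'
          · linarith
          · linarith
          · rw [e]; exact h _ b' (by omega)
      rw [h1 _ hp.le] at hX
      rw [h2 _ (by omega) (by omega)] at hY
      exact ⟨p, q + 2, by omega, le_rfl, ext _ hX, ext _ hY, by
        rw [g2 _ (by omega), g1 _ hp.le]⟩
  · rw [h1 _ le_rfl] at hX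
    rw [h2 _ (by omega) (by omega)] at hY
    have hX := shift _ le_rfl hX
    have hY := shift _ le_rfl hY
    have hX : ∀ v, p + 3 ≤ v → v ≤ q + 3 → f p < f v := by
      rcases hX with h | h
      · have := h (p + 3) le_rfl (by omega)
        linarith
      · exact h
    -- Now the left flap is the merged segment, and the same dichotomy applies to its last piece,
    -- which starts at `f (p + 2)`.
    by_cases hc : ∀ v, p + 3 ≤ v → v ≤ q + 3 → f (p + 2) < f v
    · exact ⟨p + 2, q + 2, by omega, le_rfl, .inr hc, hY, by
        rw [g2 _ le_rfl, g2 _ (by omega)]⟩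
    · push Not at hc
      obtain ⟨w, w1, w2, w3⟩ := hc
      have hw := hX w w1 w2
      have split : ∀ v, p + 1 ≤ v → v ≤ q + 3 → v = p + 1 ∨ v = p + 2 ∨ p + 3 ≤ v := by omega
      refine ⟨p, q + 2, by omega, le_rfl, .inr fun v a b => ?_, ?_, by
        rw [g1 _ le_rfl, g2 _ (by omega)]⟩
      · rcases split v a b with rfl | rfl | a
        · linarith
        · linarith
        · exact hX v a b
      · rcases hY with hY | hY
        · refine .inl fun v a b => ?_
          have := hY (p + 3) le_rfl (by omega)
          rcases split v a b with rfl | rfl | a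
          · linarith
          · linarith
          · exact hY v a b
        · refine .inr fun v a b => ?_
          have := hY w w1 w2
          rcases split v a b with rfl | rfl | a
          · linarith
          · linarith
          · exact hY v a b
  · rw [h2 _ hp (by omega)] at hX
    rw [h2 _ (by omega) (by omega)] at hY
    exact ⟨p + 2, q + 2, by omega, le_rfl, shift _ hp.le hX, shift _ hp.le hY, by
      rw [g2 _ hp.le, g2 _ (by omega)]⟩

theorem exists_interval_of_crimp {f f' : ℕ → ℝ} {G G' : ℕ → ℤ} {k N : ℕ}
    (h1 : ∀ m ≤ k, f' m = f m) (h2 : ∀ m, k < m → m ≤ N → f' m = f (m + 2))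
    (g1 : ∀ m ≤ k, G' m = G m) (g2 : ∀ m, k ≤ m → G' m = G (m + 2))
    (z : (f k ≤ f (k + 2) ∧ f (k + 2) ≤ f (k + 1) ∧ f (k + 1) ≤ f (k + 3)) ∨
      (f (k + 2) ≤ f k ∧ f (k + 1) ≤ f (k + 2) ∧ f (k + 3) ≤ f (k + 1)))
    {p q : ℕ} (hpq : p < q) (hq : q + 2 ≤ N) (hX : Avoids f' (p + 1) (q + 1) (f' p))
    (hY : Avoids f' (p + 1) (q + 1) (f' (q + 2))) :
    ∃ p₂ q₂, p₂ < q₂ ∧ q₂ ≤ q + 2 ∧ Avoids f (p₂ + 1) (q₂ + 1) (f p₂) ∧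
      Avoids f (p₂ + 1) (q₂ + 1) (f (q₂ + 2)) ∧ G (q₂ + 1) - G p₂ = G' (q + 1) - G' p := by
  rcases z with ⟨z1, z2, z3⟩ | ⟨z1, z2, z3⟩
  · exact exists_interval_of_crimp_of_le h1 h2 g1 g2 z1 z2 z3 hpq hq hX hY
  -- The opposite direction of the crimped segment is the mirror image.
  · obtain ⟨p₂, q₂, a, b, c, d, e⟩ := exists_interval_of_crimp_of_le (f := -f) (f' := -f')
      (fun m hm => congrArg Neg.neg (h1 m hm)) (fun m a b => congrArg Neg.neg (h2 m a b)) g1 g2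
      (neg_le_neg z1) (neg_le_neg z2) (neg_le_neg z3) hpq hq hX.neg hY.neg
    exact ⟨p₂, q₂, a, b, by simpa using c.neg, by simpa using d.neg, e⟩

variable {n : ℕ}

theorem segLen_eq (P : CreasePattern n) {m : ℕ} (h : m ≤ n) :
    P.segLen m = natExt P.vertex (m + 1) - natExt P.vertex m := by
  rw [segLen, natExt_of_lt _ (by omega), natExt_of_lt _ (by omega), natExt_of_lt _ (by omega)]
  rfl

/-! ### Effect of a crimp on folded positions and sums of turns -/

section crimp
variable (P : CreasePattern (n + 2)) (k : Fin (n + 1)) (h : P.Crimpable k)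
include h

theorem segLen_le_of_crimpable : P.segLen (k + 1) ≤ P.segLen k ∧
    P.segLen (k + 1) ≤ P.segLen (k + 2) := by
  simp only [segLen]
  rw [natExt_of_lt _ (by omega), natExt_of_lt _ (by omega), natExt_of_lt _ (by omega)]
  exact ⟨h.1, h.2.1⟩

theorem natExt_vertex_crimp_of_le {m : ℕ} (hm : m ≤ k) :
    natExt (P.crimp k h).vertex m = natExt P.vertex m := by
  rw [natExt_of_lt _ (by omega), natExt_of_lt _ (by omega)]
  exact if_pos hm

theorem natExt_vertex_crimp_of_gt {m : ℕ} (hm : k < m) (hm' : m ≤ n + 1) :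
    natExt (P.crimp k h).vertex m = natExt P.vertex (m + 2) - 2 * P.segLen (k + 1) := by
  rw [natExt_of_lt _ (by omega), natExt_of_lt _ (by omega), segLen, natExt_of_lt _ (by omega)]
  exact if_neg (not_le.2 hm)

theorem fpos_crimp_of_le {m : ℕ} (hm : m ≤ k) : (P.crimp k h).fpos m = P.fpos m := by
  induction m with
  | zero =>
    rw [fpos_zero, fpos_zero]
    have := P.natExt_vertex_crimp_of_le k h hm
    rwa [natExt_of_lt _ (by omega), natExt_of_lt _ (by omega)] at this
  | succ m ih =>
    rw [fpos_succ _ (by omega), fpos_succ _ (by omega), ih (by omega), segLen_eq _ (by omega),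
      segLen_eq _ (by omega), P.natExt_vertex_crimp_of_le k h hm,
      P.natExt_vertex_crimp_of_le k h (by omega)]

/-- The folded map already reverses at the two crimped creases, and removing two vertices keeps the
parity of the later segments; hence the remaining vertices keep their folded positions. -/
theorem fpos_crimp_of_gt {m : ℕ} (hm : k < m) (hm' : m ≤ n + 1) :
    (P.crimp k h).fpos m = P.fpos (m + 2) := by
  induction m, Nat.succ_le_of_lt hm using Nat.le_induction with
  | base =>
    rw [Nat.succ_eq_add_one, fpos_succ _ (by omega), P.fpos_crimp_of_le k h le_rfl,
      fpos_succ _ (by omega), fpos_succ _ (by omega),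
      fpos_succ _ (by omega), segLen_eq _ (by omega), P.natExt_vertex_crimp_of_le k h le_rfl,
      P.natExt_vertex_crimp_of_gt k h (by omega) (by omega), segLen_eq _ (by omega),
      segLen_eq _ (by omega), segLen_eq _ (by omega), pow_succ, pow_succ]
    ring_nf
  | succ m hm1 ih =>
    change _ = P.fpos (m + 2 + 1)
    rw [fpos_succ _ (by omega), ih (by omega) (by omega), fpos_succ _ (m := m + 2) (by omega),
      segLen_eq _ (by omega), segLen_eq _ (by omega), P.natExt_vertex_crimp_of_gt k h (by omega) hm',
      P.natExt_vertex_crimp_of_gt k h (by omega) (by omega), pow_add]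
    ring_nf

theorem creaseTurn_crimp (j : ℕ) : (P.crimp k h).creaseTurn j =
    if j < k then P.creaseTurn j else P.creaseTurn (j + 2) := by
  unfold creaseTurn
  by_cases hj : j < n
  · rw [natExt_of_lt _ hj, natExt_of_lt _ (by omega), natExt_of_lt _ (by omega)]
    simp only [crimp]
    split_ifs <;> rfl
  · rw [if_neg (by omega), natExt, natExt, dif_neg hj, dif_neg (by omega)]

theorem creaseTurn_add_of_crimpable : P.creaseTurn k + P.creaseTurn (k + 1) = 0 := by
  unfold creaseTurn
  rw [natExt_of_lt _ (by omega), natExt_of_lt _ (by omega)]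
  have := h.2.2
  change P.label ⟨k, _⟩ ≠ P.label ⟨k + 1, _⟩ at this
  generalize P.label ⟨k, _⟩ = a at *
  generalize P.label ⟨k + 1, _⟩ = b at *
  cases a <;> cases b <;> simp_all [turnOf]

theorem crimp_innocent (H : ∀ p q, P.Suspicious p q → P.Innocent p q) (p q : Fin n)
    (hpq : (P.crimp k h).Suspicious p q) : (P.crimp k h).Innocent p q := by
  obtain ⟨hlt, hX, hY⟩ := (suspicious_iff _ p q).1 hpq
  have ct := P.creaseTurn_crimp k h
  have c0 := P.creaseTurn_add_of_crimpable k h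
  have b := P.segLen_le_of_crimpable k h
  have b0 := P.segLen_pos (m := k + 1) (by omega)
  have f1 := P.fpos_succ (m := k) (by omega)
  have f2 := P.fpos_succ (m := k + 1) (by omega)
  have f3 := P.fpos_succ (m := k + 2) (by omega)
  have z : (P.fpos k ≤ P.fpos (k + 2) ∧ P.fpos (k + 2) ≤ P.fpos (k + 1) ∧
      P.fpos (k + 1) ≤ P.fpos (k + 3)) ∨ (P.fpos (k + 2) ≤ P.fpos k ∧
      P.fpos (k + 1) ≤ P.fpos (k + 2) ∧ P.fpos (k + 3) ≤ P.fpos (k + 1)) := by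
    rw [pow_succ] at f2
    rw [pow_add] at f3
    have e2 : P.fpos (k + 1 + 1) = P.fpos (k + 2) := rfl
    have e3 : P.fpos (k + 2 + 1) = P.fpos (k + 3) := rfl
    rcases neg_one_pow_eq_or ℝ (k : ℕ) with e | e <;> rw [e] at f1 f2 f3
    · exact .inl ⟨by linarith, by linarith, by linarith⟩
    · exact .inr ⟨by linarith, by linarith, by linarith⟩
  have g1 : ∀ m ≤ (k : ℕ), ∑ j ∈ Finset.range m, (P.crimp k h).creaseTurn j =
      ∑ j ∈ Finset.range m, P.creaseTurn j := fun m hm =>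
    Finset.sum_congr rfl fun j hj => by
      rw [ct, if_pos ((Finset.mem_range.1 hj).trans_le hm)]
  have g2 : ∀ m, (k : ℕ) ≤ m → ∑ j ∈ Finset.range m, (P.crimp k h).creaseTurn j =
      ∑ j ∈ Finset.range (m + 2), P.creaseTurn j := by
    intro m hm
    induction m, hm using Nat.le_induction with
    | base => rw [g1 _ le_rfl, Finset.sum_range_succ, Finset.sum_range_succ, add_assoc, c0, add_zero]
    | succ m hm ih =>
      change _ = ∑ j ∈ Finset.range (m + 2 + 1), P.creaseTurn j
      rw [Finset.sum_range_succ, ih, Finset.sum_range_succ _ (m + 2), ct, if_neg (by omega)]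
  obtain ⟨p₂, q₂, i1, i2, i3, i4, i5⟩ := exists_interval_of_crimp (N := n + 1)
    (fun m hm => P.fpos_crimp_of_le k h hm) (fun m hm hm' => P.fpos_crimp_of_gt k h hm hm')
    g1 g2 z hlt (by omega) hX hY
  have H := (innocent_iff _ _ _).1 (H ⟨p₂, by omega⟩ ⟨q₂, by omega⟩
    ((suspicious_iff _ _ _).2 ⟨by simpa using i1, i3, i4⟩))
  rw [innocent_iff]
  have sumIcc : ∀ (g : ℕ → ℤ) a b, a < b → ∑ j ∈ Finset.Icc a b, g j =
      ∑ j ∈ Finset.range (b + 1), g j - ∑ j ∈ Finset.range a, g j := by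
    intro g a b hab
    rw [← Finset.sum_Ico_eq_sub _ (by omega)]
    rfl
  rw [sumIcc _ _ _ i1, i5] at H
  rwa [sumIcc _ _ _ hlt]

end crimp

/-! ### Effect of an end fold -/

theorem rightEndFold_innocent (P : CreasePattern (n + 1))
    (H : ∀ p q, P.Suspicious p q → P.Innocent p q) (p q : Fin n)
    (hpq : P.rightEndFold.Suspicious p q) : P.rightEndFold.Innocent p q := by
  obtain ⟨hlt, hX, hY⟩ := (suspicious_iff _ p q).1 hpq
  have v : ∀ m ≤ n + 1, natExt P.rightEndFold.vertex m = natExt P.vertex m := fun m hm => by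
    rw [natExt_of_lt _ (by omega), natExt_of_lt _ (by omega)]; rfl
  have f : ∀ m ≤ n + 1, P.rightEndFold.fpos m = P.fpos m := by
    intro m hm
    induction m with
    | zero => rw [fpos_zero, fpos_zero]; rfl
    | succ m ih =>
      rw [fpos_succ _ (by omega), fpos_succ _ (by omega), ih (by omega), segLen_eq _ (by omega),
        segLen_eq _ (by omega), v _ (by omega), v _ (by omega)]
  have av : ∀ y, Avoids P.rightEndFold.fpos (p + 1) (q + 1) y → Avoids P.fpos (p + 1) (q + 1) y :=
    fun y h => h.imp (fun h v a b => f v (by omega) ▸ h v a b)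
      fun h v a b => f v (by omega) ▸ h v a b
  rw [f _ (by omega)] at hX hY
  have H := (innocent_iff _ _ _).1 (H ⟨p, by omega⟩ ⟨q, by omega⟩
    ((suspicious_iff _ _ _).2 ⟨hlt, av _ hX, av _ hY⟩))
  rw [innocent_iff]
  convert H using 2
  refine Finset.sum_congr rfl fun j hj => ?_
  rw [Finset.mem_Icc] at hj
  dsimp only at hj
  unfold creaseTurn
  rw [natExt_of_lt _ (by omega), natExt_of_lt _ (by omega)]
  rfl

theorem leftEndFold_innocent (P : CreasePattern (n + 1))
    (H : ∀ p q, P.Suspicious p q → P.Innocent p q) (p q : Fin n)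
    (hpq : P.leftEndFold.Suspicious p q) : P.leftEndFold.Innocent p q := by
  obtain ⟨hlt, hX, hY⟩ := (suspicious_iff _ p q).1 hpq
  have v : ∀ m ≤ n + 1, natExt P.leftEndFold.vertex m = natExt P.vertex (m + 1) := fun m hm => by
    rw [natExt_of_lt _ (by omega), natExt_of_lt _ (by omega)]; rfl
  -- Deleting one segment changes the parity of all the others, so the folded map is reflected;
  -- avoidance then merely exchanges its two sides.
  have f : ∀ m ≤ n + 1, P.leftEndFold.fpos m = P.leftEndFold.fpos 0 + P.fpos 1 - P.fpos (m + 1) := by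
    intro m hm
    induction m with
    | zero => ring
    | succ m ih =>
      rw [fpos_succ _ (by omega), fpos_succ _ (m := m + 1) (by omega), ih (by omega),
        segLen_eq _ (by omega), segLen_eq _ (by omega), v _ (by omega), v _ (by omega), pow_succ]
      ring
  have av : ∀ m ≤ n + 1, Avoids P.leftEndFold.fpos (p + 1) (q + 1) (P.leftEndFold.fpos m) →
      Avoids P.fpos (p + 1 + 1) (q + 1 + 1) (P.fpos (m + 1)) := by
    intro m hm h
    refine h.symm.imp (fun h v a b => ?_) fun h v a b => ?_ <;>
    · have := h (v - 1) (by omega) (by omega)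
      have e1 := f m hm
      have e2 := f (v - 1) (by omega)
      rw [Nat.sub_add_cancel (by omega)] at e2
      linarith
  have H := (innocent_iff _ _ _).1 (H ⟨p + 1, by omega⟩ ⟨q + 1, by omega⟩
    ((suspicious_iff _ _ _).2 ⟨by simpa using hlt, av _ (by omega) hX, av _ (by omega) hY⟩))
  rw [innocent_iff]
  convert H using 2
  dsimp only
  rw [← Finset.map_add_right_Icc, Finset.sum_map]
  refine Finset.sum_congr rfl fun j hj => ?_
  rw [Finset.mem_Icc] at hj
  unfold creaseTurn
  rw [addRightEmbedding_apply]
  rw [natExt_of_lt _ (by omega), natExt_of_lt _ (by omega)]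
  rfl

/-! ### Existence of a crimp or an end fold -/

/-- Segments `i` to `e - 1` form the first maximal run of shortest segments. The ends are not
foldable, so the run is interior and its flaps are strictly longer, which makes the interval
suspicious. Without a crimp all its creases, at least two, would have the same label, against
innocence. -/
theorem exists_crimpable (P : CreasePattern (n + 2))
    (H : ∀ p q, P.Suspicious p q → P.Innocent p q) (hl : ¬ P.LeftEndFoldable)
    (hr : ¬ P.RightEndFoldable) : ∃ k, P.Crimpable k := by
  by_contra hc
  push Not at hc
  have hl : P.segLen 1 < P.segLen 0 := by
    unfold segLen
    rw [natExt_of_lt _ (by omega), natExt_of_lt _ (by omega)]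
    exact not_le.1 hl
  have hr : P.segLen (n + 1) < P.segLen (n + 2) := by
    unfold segLen
    rw [natExt_of_lt _ (by omega), natExt_of_lt _ (by omega)]
    exact not_le.1 hr
  have hmin : ∃ i ≤ n + 2, ∀ k ≤ n + 2, P.segLen i ≤ P.segLen k := by
    obtain ⟨i, hi, h⟩ := Finset.exists_min_image (Finset.range (n + 3)) P.segLen ⟨0, by simp⟩
    exact ⟨i, by simpa [Nat.lt_succ_iff] using hi, fun k hk => h k (by simpa [Nat.lt_succ_iff] using hk)⟩
  classical
  obtain ⟨hi, hmin'⟩ := Nat.find_spec hmin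
  have hfirst := fun k hk => Nat.find_min hmin (m := k) hk
  generalize Nat.find hmin = i at hi hmin' hfirst
  have hi0 : 0 < i := by
    rcases Nat.eq_zero_or_pos i with rfl | h
    · have := hmin' 1 (by omega)
      linarith
    · exact h
  have hi1 : P.segLen i < P.segLen (i - 1) := by
    refine lt_of_le_of_ne (hmin' _ (by omega)) fun e => ?_
    exact hfirst (i - 1) (by omega) ⟨by omega, e ▸ hmin'⟩
  have hex : ∃ e, i < e ∧ e ≤ n + 2 ∧ P.segLen e ≠ P.segLen i := by
    have h1 := hmin' (n + 1) (by omega)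
    refine ⟨n + 2, lt_of_le_of_ne hi fun e => ?_, le_rfl, (h1.trans_lt hr).ne'⟩
    rw [e] at h1
    linarith
  obtain ⟨hie, he, hne⟩ := Nat.find_spec hex
  have hlast := fun k hk => Nat.find_min hex (m := k) hk
  generalize Nat.find hex = e at hie he hne hlast
  have he1 : P.segLen i < P.segLen e := lt_of_le_of_ne (hmin' e he) hne.symm
  have heq : ∀ v, i ≤ v → v < e → P.segLen v = P.segLen i := by
    intro v hv hve
    by_contra hc
    refine hlast v hve ⟨lt_of_le_of_ne hv ?_, by omega, hc⟩
    rintro rfl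
    exact hc rfl
  -- Equal segments fold onto one another, so the vertices of the run alternate between two
  -- positions.
  have hf : ∀ v, i ≤ v → v ≤ e →
      P.fpos v = P.fpos i + ((-1) ^ i - (-1) ^ v) * (P.segLen i / 2) := by
    intro v hv
    induction v, hv using Nat.le_induction with
    | base => intro _; ring
    | succ v hv ih =>
      intro hve
      rw [P.fpos_succ (by omega), ih (by omega), heq v hv (by omega), pow_succ]
      ring
  have hpos := P.segLen_pos hi
  have hX : P.fpos (i - 1) = P.fpos i + (-1) ^ i * P.segLen (i - 1) := by
    obtain ⟨i', rfl⟩ : ∃ i', i = i' + 1 := ⟨i - 1, by omega⟩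
    rw [Nat.add_sub_cancel, P.fpos_succ (by omega), pow_succ]
    ring
  have hY : P.fpos (e + 1) = _ := P.fpos_succ he
  rw [hf e (by omega) le_rfl] at hY
  have av : Avoids P.fpos i e (P.fpos (i - 1)) ∧ Avoids P.fpos i e (P.fpos (e + 1)) := by
    rcases neg_one_pow_eq_or ℝ i with h | h <;> rcases neg_one_pow_eq_or ℝ e with h' | h' <;>
      rw [h, h'] at hY <;> rw [h] at hX hf <;> constructor <;>
      first
      | (refine .inl fun v a b => ?_
         rw [hf v a b]
         rcases neg_one_pow_eq_or ℝ v with h'' | h'' <;> rw [h''] <;> linarith)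
      | (refine .inr fun v a b => ?_
         rw [hf v a b]
         rcases neg_one_pow_eq_or ℝ v with h'' | h'' <;> rw [h''] <;> linarith)
  have hinn := (innocent_iff _ _ _).1 (H ⟨i - 1, by omega⟩ ⟨e - 1, by omega⟩
    ((suspicious_iff _ _ _).2 ⟨by simp [Fin.lt_def]; omega, by
      dsimp only
      rw [Nat.sub_add_cancel hi0, Nat.sub_add_cancel (by omega)]
      exact av.1, by
      dsimp only
      rw [Nat.sub_add_cancel hi0, Nat.sub_add_cancel (by omega),
        show e - 1 + 2 = e + 1 by omega]
      exact av.2⟩))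
  -- A shortest segment meets the length conditions of a crimp, so only equal labels can prevent it.
  have hstep : ∀ v, i ≤ v → v < e → P.creaseTurn v = P.creaseTurn (v - 1) := by
    intro v hv hve
    have h1 := hmin' (v - 1) (by omega)
    have h2 := hmin' (v + 1) (by omega)
    rw [← heq v hv hve] at h1 h2
    obtain ⟨k, rfl⟩ : ∃ k, v = k + 1 := ⟨v - 1, by omega⟩
    rw [Nat.add_sub_cancel] at h1 ⊢
    unfold segLen at h1 h2
    rw [natExt_of_lt _ (by omega), natExt_of_lt _ (by omega)] at h1 h2
    unfold creaseTurn
    rw [natExt_of_lt _ (by omega), natExt_of_lt _ (by omega)]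
    by_contra hne
    exact hc ⟨k, by omega⟩ ⟨h1, h2, fun e => hne (congrArg turnOf e).symm⟩
  have hall : ∀ v, i - 1 ≤ v → v < e → P.creaseTurn v = P.creaseTurn (i - 1) := by
    intro v hv
    induction v, hv using Nat.le_induction with
    | base => intro _; rfl
    | succ v hv ih => intro hve; rw [hstep _ (by omega) hve, Nat.add_sub_cancel, ih (by omega)]
  rw [Finset.sum_congr rfl fun v hv => hall v (Finset.mem_Icc.1 hv).1
      (by have := (Finset.mem_Icc.1 hv).2; dsimp only at this; omega), Finset.sum_const,
    Nat.card_Icc, nsmul_eq_mul, abs_mul, Nat.abs_cast] at hinn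
  have : |P.creaseTurn (i - 1)| = 1 := by
    unfold creaseTurn
    rw [natExt_of_lt _ (by omega)]
    cases P.label ⟨i - 1, _⟩ <;> rfl
  rw [this] at hinn
  dsimp only at hinn
  omega

theorem foldableByCrimpsAndEndFolds_of_innocent : ∀ {n : ℕ} (P : CreasePattern n),
    (∀ p q, P.Suspicious p q → P.Innocent p q) → P.FoldableByCrimpsAndEndFolds := by
  intro n
  induction n using Nat.strong_induction_on with
  | _ n ih =>
    intro P H
    match n, P with
    | 0, P => exact .done P
    | 1, P =>
      by_cases hl : P.LeftEndFoldable
      · exact .leftEnd P hl (ih 0 (by omega) _ (P.leftEndFold_innocent H))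
      · exact .rightEnd P (le_of_not_ge hl) (ih 0 (by omega) _ (P.rightEndFold_innocent H))
    | n + 2, P =>
      by_cases hl : P.LeftEndFoldable
      · exact .leftEnd P hl (ih (n + 1) (by omega) _ (P.leftEndFold_innocent H))
      by_cases hr : P.RightEndFoldable
      · exact .rightEnd P hr (ih (n + 1) (by omega) _ (P.rightEndFold_innocent H))
      obtain ⟨k, hk⟩ := P.exists_crimpable H hl hr
      exact .crimp P k hk (ih n (by omega) _ (P.crimp_innocent k hk H))

end CreasePattern

namespace CreasePattern
namespace Placement

/-! ### Simple folds lead to flat foldings -/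

variable {n : ℕ} {P : CreasePattern n}

/-- A placement in which some of the creases are folded, in their assigned orientations, and the
layers do not cross. -/
structure IsPartialFolding (s : P.Placement) : Prop where
  layer_eq : ∀ j, ¬ s.Folded j → s.layer j.castSucc = s.layer j.succ
  respects : ∀ j, s.Folded j → s.Respects j
  layered : ∀ i k, i ≠ k → s.Overlap i k → s.layer i ≠ s.layer k
  not_through : ∀ j k, s.Folded j → s.creasePos j ∈ s.interiorImage k → ¬ s.Between j k
  -- An unfolded crease lies in the middle of a flat layer but in the interior of neither of its
  -- segments, so `not_through` does not cover it.
  not_through_unfolded : ∀ j j', s.Folded j → ¬ s.Folded j' → s.creasePos j = s.creasePos j' →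
    ¬ s.Between j j'.castSucc
  not_interleaved : ∀ j j', s.Folded j → s.Folded j' → s.creasePos j = s.creasePos j' →
    s.Overlap j.castSucc j'.castSucc → (s.Between j j'.castSucc ↔ s.Between j j'.succ)

theorem between_iff (s : P.Placement) (j : Fin n) (k : Fin (n + 1)) : s.Between j k ↔
    (s.layer j.castSucc < s.layer k ∧ s.layer k < s.layer j.succ) ∨
    (s.layer j.succ < s.layer k ∧ s.layer k < s.layer j.castSucc) := by
  unfold Between
  omega

theorem Overlap.of_folded {s : P.Placement} {j j' : Fin n} (hj : s.Folded j) (hj' : s.Folded j')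
    (e : s.creasePos j = s.creasePos j') (h : s.Overlap j.castSucc j'.castSucc) :
    s.Overlap j.castSucc j'.succ ∧ s.Overlap j.succ j'.castSucc ∧ s.Overlap j.succ j'.succ := by
  simp only [overlap_iff, folded_iff, creasePos] at *
  rw [show j.succ.castSucc = j.castSucc.succ from rfl,
    show j'.succ.castSucc = j'.castSucc.succ from rfl]
  simp only [min_lt_iff, lt_max_iff] at *
  rcases hj with ⟨a, b⟩ | ⟨a, b⟩ <;> rcases hj' with ⟨c, d⟩ | ⟨c, d⟩
  · exact ⟨⟨by grind, by grind⟩, ⟨by grind, by grind⟩, by grind, by grind⟩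
  · exfalso; grind
  · exfalso; grind
  · exact ⟨⟨by grind, by grind⟩, ⟨by grind, by grind⟩, by grind, by grind⟩

/-- A segment has positive length, so its two ends cannot be at the same place. -/
theorem segment_ne_of_creasePos_eq {s : P.Placement} {j j' : Fin n} (hne : j ≠ j')
    (e : s.creasePos j = s.creasePos j') {a b : Fin (n + 1)} (ha : a = j.castSucc ∨ a = j.succ)
    (hb : b = j'.castSucc ∨ b = j'.succ) : a ≠ b := by
  rcases ha with rfl | rfl <;> rcases hb with rfl | rfl <;> intro hab
  · exact hne (Fin.castSucc_injective _ hab)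
  · refine s.pos_ne j.castSucc ?_
    change _ = s.creasePos j
    rw [e, hab]
    rfl
  · refine s.pos_ne j.succ ?_
    change s.creasePos j = _
    rw [e, hab]
    rfl
  · exact hne (Fin.succ_injective _ hab)

theorem faceUp_unfolded (P : CreasePattern n) (i : Fin (n + 1)) : (unfolded P).FaceUp i :=
  P.strictMono i.castSucc_lt_succ

theorem not_folded_unfolded (P : CreasePattern n) (j : Fin n) : ¬ (unfolded P).Folded j := fun h =>
  h ⟨fun _ => faceUp_unfolded P _, fun _ => faceUp_unfolded P _⟩

theorem not_overlap_unfolded (P : CreasePattern n) {i k : Fin (n + 1)} (hne : i ≠ k) :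
    ¬ (unfolded P).Overlap i k := by
  intro h
  rw [overlap_iff] at h
  have m : ∀ {i k : Fin (n + 1)}, i < k → P.vertex i.succ ≤ P.vertex k.castSucc := fun h =>
    P.strictMono.monotone (Fin.succ_le_castSucc_iff.2 h)
  have ui := faceUp_unfolded P i
  have uk := faceUp_unfolded P k
  simp only [FaceUp, unfolded] at h ui uk
  rw [min_eq_left ui.le, min_eq_left uk.le, max_eq_right ui.le, max_eq_right uk.le] at h
  rcases lt_or_gt_of_ne hne with hik | hik
  · exact (m hik).not_gt h.2
  · exact (m hik).not_gt h.1

theorem isPartialFolding_unfolded (P : CreasePattern n) : (unfolded P).IsPartialFolding :=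
  ⟨fun _ _ => rfl, fun j h => (not_folded_unfolded P j h).elim,
    fun _ _ hne h => (not_overlap_unfolded P hne h).elim,
    fun j _ h => (not_folded_unfolded P j h).elim, fun j _ h => (not_folded_unfolded P j h).elim,
    fun j _ h => (not_folded_unfolded P j h).elim⟩

/-! ### A simple fold preserves non-crossing -/

namespace IsFoldAt

variable {s t : P.Placement} {x : ℝ} {M : Set (Fin (n + 1))} (h : s.IsFoldAt t x M)
include h

theorem creasePos_of_castSucc_mem {j : Fin n} (hj : j.castSucc ∈ M) :
    t.creasePos j = 2 * x - s.creasePos j := (h.pos_moved _ hj).2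

theorem creasePos_of_castSucc_notMem {j : Fin n} (hj : j.castSucc ∉ M) :
    t.creasePos j = s.creasePos j := (h.pos_unmoved _ hj).2

theorem creasePos_of_mem_hinges {j : Fin n} (hj : j ∈ hinges M) : t.creasePos j = x := by
  have := (h.hinge_pos j hj).1
  by_cases hm : j.castSucc ∈ M
  · rw [h.creasePos_of_castSucc_mem hm]; linarith
  · rw [h.creasePos_of_castSucc_notMem hm, this]

theorem faceUp_of_mem {i : Fin (n + 1)} (hi : i ∈ M) : t.FaceUp i ↔ ¬ s.FaceUp i := by
  have := s.pos_ne i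
  unfold FaceUp
  rw [(h.pos_moved i hi).1, (h.pos_moved i hi).2, not_lt]
  exact ⟨fun h => by linarith, fun h => by have := lt_of_le_of_ne h this.symm; linarith⟩

theorem faceUp_of_notMem {i : Fin (n + 1)} (hi : i ∉ M) : t.FaceUp i ↔ s.FaceUp i := by
  unfold FaceUp
  rw [(h.pos_unmoved i hi).1, (h.pos_unmoved i hi).2]

theorem folded_of_mem_hinges {j : Fin n} (hj : j ∈ hinges M) : t.Folded j := by
  have := (h.hinge_pos j hj).2
  unfold Folded at *
  rcases hj with ⟨h1, h2⟩ | ⟨h1, h2⟩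
  · rw [h.faceUp_of_mem h1, h.faceUp_of_notMem h2]; tauto
  · rw [h.faceUp_of_mem h1, h.faceUp_of_notMem h2]; tauto

theorem folded_iff_of_iff {j : Fin n} (hj : j.castSucc ∈ M ↔ j.succ ∈ M) :
    t.Folded j ↔ s.Folded j := by
  unfold Folded
  by_cases hm : j.castSucc ∈ M
  · rw [h.faceUp_of_mem hm, h.faceUp_of_mem (hj.1 hm), not_iff_not, not_iff_not]
  · rw [h.faceUp_of_notMem hm, h.faceUp_of_notMem (mt hj.2 hm)]

theorem overlap_of_mem {i k : Fin (n + 1)} (hi : i ∈ M) (hk : k ∈ M) :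
    t.Overlap i k → s.Overlap i k := by
  simp only [overlap_iff]
  rw [(h.pos_moved i hi).1, (h.pos_moved i hi).2, (h.pos_moved k hk).1, (h.pos_moved k hk).2]
  simp only [min_lt_iff, lt_max_iff]
  grind

theorem overlap_of_notMem {i k : Fin (n + 1)} (hi : i ∉ M) (hk : k ∉ M) :
    t.Overlap i k → s.Overlap i k := by
  simp only [overlap_iff]
  rw [(h.pos_unmoved i hi).1, (h.pos_unmoved i hi).2, (h.pos_unmoved k hk).1,
    (h.pos_unmoved k hk).2]
  exact id

theorem mem_interiorImage_of_mem {k : Fin (n + 1)} (hk : k ∈ M) {y : ℝ}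
    (hy : 2 * x - y ∈ t.interiorImage k) : y ∈ s.interiorImage k := by
  unfold interiorImage at *
  rw [(h.pos_moved k hk).1, (h.pos_moved k hk).2] at hy
  simp only [Set.mem_Ioo, min_lt_iff, lt_max_iff] at *
  grind

theorem mem_interiorImage_of_notMem {k : Fin (n + 1)} (hk : k ∉ M) {y : ℝ}
    (hy : y ∈ t.interiorImage k) : y ∈ s.interiorImage k := by
  unfold interiorImage at *
  rwa [(h.pos_unmoved k hk).1, (h.pos_unmoved k hk).2] at hy

theorem notMem_of_mem_interiorImage {k : Fin (n + 1)} (hx : x ∈ t.interiorImage k) : k ∉ M := by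
  intro hk
  unfold interiorImage at hx
  rw [(h.pos_moved k hk).1, (h.pos_moved k hk).2, Set.mem_Ioo, min_lt_iff, lt_max_iff] at hx
  rcases h.one_side with o | o <;> have := o k hk <;> grind

omit h in
theorem overlap_of_hinge {a k : Fin (n + 1)} (hax : s.pos a.castSucc = x ∨ s.pos a.succ = x)
    (hx : x ∈ s.interiorImage k) : s.Overlap a k := by
  rw [overlap_iff]
  have h1 : min (s.pos a.castSucc) (s.pos a.succ) ≤ x := by
    rcases hax with rfl | rfl
    exacts [min_le_left _ _, min_le_right _ _]
  have h2 : x ≤ max (s.pos a.castSucc) (s.pos a.succ) := by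
    rcases hax with rfl | rfl
    exacts [le_max_left _ _, le_max_right _ _]
  exact ⟨h1.trans_lt hx.2, hx.1.trans_le h2⟩

theorem overlap_of_hinge_of_not_folded {a : Fin (n + 1)} (ha : a ∈ M)
    (hax : s.pos a.castSucc = x ∨ s.pos a.succ = x) {j : Fin n} (hj : ¬ s.Folded j)
    (hx : s.creasePos j = x) : s.Overlap a j.castSucc ∨ s.Overlap a j.succ := by
  have n1 := s.pos_ne a
  have n2 := s.pos_ne j.castSucc
  have n3 := s.pos_ne j.succ
  have h1 : min (s.pos a.castSucc) (s.pos a.succ) ≤ x := by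
    rcases hax with h | h
    exacts [h ▸ min_le_left _ _, h ▸ min_le_right _ _]
  have h2 : x ≤ max (s.pos a.castSucc) (s.pos a.succ) := by
    rcases hax with h | h
    exacts [h ▸ le_max_left _ _, h ▸ le_max_right _ _]
  simp only [overlap_iff]
  rw [folded_iff] at hj
  unfold creasePos at hx
  rw [show j.succ.castSucc = j.castSucc.succ from rfl, hx] at n3 ⊢
  rw [hx] at n2 hj
  push Not at hj
  rcases h.one_side with o | o
  · have h3 : x < max (s.pos a.castSucc) (s.pos a.succ) := by
      rw [lt_max_iff]
      rcases hax with e | e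
      · exact .inr (lt_of_le_of_ne (o a ha).2 (e ▸ n1))
      · exact .inl (lt_of_le_of_ne (o a ha).1 (e ▸ n1.symm))
    rcases lt_or_gt_of_ne n2 with c | c
    · have := lt_of_le_of_ne (hj.1 c) n3
      exact .inr ⟨h1.trans_lt (lt_max_of_lt_right this), (min_le_left _ _).trans_lt h3⟩
    · exact .inl ⟨h1.trans_lt (lt_max_of_lt_left c), (min_le_right _ _).trans_lt h3⟩
  · have h3 : min (s.pos a.castSucc) (s.pos a.succ) < x := by
      rw [min_lt_iff]
      rcases hax with e | e
      · exact .inr (lt_of_le_of_ne (o a ha).2 (e ▸ n1.symm))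
      · exact .inl (lt_of_le_of_ne (o a ha).1 (e ▸ n1))
    rcases lt_or_gt_of_ne n2 with c | c
    · exact .inl ⟨h3.trans_le (le_max_right _ _), (min_lt_of_left_lt c).trans_le h2⟩
    · have := lt_of_le_of_ne (hj.2 c) n3.symm
      exact .inr ⟨h3.trans_le (le_max_left _ _), (min_lt_of_right_lt this).trans_le h2⟩

/-- A hinge joins a moved segment `a` and an unmoved segment `b`. -/
theorem exists_of_mem_hinges (hs : s.IsPartialFolding) {j : Fin n} (hj : j ∈ hinges M) :
    ∃ a ∈ M, ∃ b ∉ M, (a = j.castSucc ∧ b = j.succ ∨ a = j.succ ∧ b = j.castSucc) ∧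
      s.layer j.castSucc = s.layer a ∧ s.layer a = t.layer b ∧
      (s.pos a.castSucc = x ∨ s.pos a.succ = x) ∧
      ∀ k, t.Between j k ↔ (t.layer a < t.layer k ∧ t.layer k < t.layer b) ∨
        (t.layer b < t.layer k ∧ t.layer k < t.layer a) := by
  have e := hs.layer_eq j (h.hinge_pos j hj).2
  have ex := (h.hinge_pos j hj).1
  rcases hj with ⟨h1, h2⟩ | ⟨h1, h2⟩
  · exact ⟨_, h1, _, h2, .inl ⟨rfl, rfl⟩, rfl, by rw [h.layer_unmoved _ h2, e], .inr ex,
      fun k => t.between_iff j k⟩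
  · exact ⟨_, h1, _, h2, .inr ⟨rfl, rfl⟩, e, by rw [h.layer_unmoved _ h2, e], .inl ex,
      fun k => (t.between_iff j k).trans or_comm⟩

theorem layered (hs : s.IsPartialFolding) (i k : Fin (n + 1)) (hne : i ≠ k)
    (ho : t.Overlap i k) : t.layer i ≠ t.layer k := by
  obtain ⟨c, hc⟩ := h.layer_moved
  by_cases hi : i ∈ M <;> by_cases hk : k ∈ M
  · rw [hc i hi, hc k hk]
    have := hs.layered i k hne (h.overlap_of_mem hi hk ho)
    omega
  · rcases h.outermost with ⟨-, o⟩ | ⟨-, o⟩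
    · exact (o i hi k hk).ne'
    · exact (o i hi k hk).ne
  · rcases h.outermost with ⟨-, o⟩ | ⟨-, o⟩
    · exact (o k hk i hi).ne
    · exact (o k hk i hi).ne'
  · rw [h.layer_unmoved i hi, h.layer_unmoved k hk]
    exact hs.layered i k hne (h.overlap_of_notMem hi hk ho)

theorem not_between_of_mem {j : Fin n} {k : Fin (n + 1)} (h1 : j.castSucc ∈ M) (h2 : j.succ ∈ M)
    (hk : k ∉ M) : ¬ t.Between j k := by
  rw [between_iff]
  rcases h.outermost with ⟨-, o⟩ | ⟨-, o⟩ <;> have := o _ h1 k hk <;> have := o _ h2 k hk <;> omega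

theorem not_between_of_notMem {j : Fin n} {k : Fin (n + 1)} (h1 : j.castSucc ∉ M)
    (h2 : j.succ ∉ M) (hk : k ∈ M) : ¬ t.Between j k := by
  rw [between_iff]
  rcases h.outermost with ⟨-, o⟩ | ⟨-, o⟩ <;> have := o k hk _ h1 <;> have := o k hk _ h2 <;> omega

theorem between_of_mem {j : Fin n} {k : Fin (n + 1)} (h1 : j.castSucc ∈ M) (h2 : j.succ ∈ M)
    (hk : k ∈ M) : t.Between j k ↔ s.Between j k := by
  obtain ⟨c, hc⟩ := h.layer_moved
  rw [between_iff, between_iff, hc _ h1, hc _ h2, hc _ hk]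
  omega

theorem between_of_notMem {j : Fin n} {k : Fin (n + 1)} (h1 : j.castSucc ∉ M) (h2 : j.succ ∉ M)
    (hk : k ∉ M) : t.Between j k ↔ s.Between j k := by
  rw [between_iff, between_iff, h.layer_unmoved _ h1, h.layer_unmoved _ h2, h.layer_unmoved _ hk]

omit h in
theorem castSucc_mem_iff {j : Fin n} (hj : j ∉ hinges M) : j.castSucc ∈ M ↔ j.succ ∈ M := by
  have : ¬ Xor (j.castSucc ∈ M) (j.succ ∈ M) := hj
  unfold Xor at this
  tauto

theorem creasePos_eq_of_iff {j j' : Fin n} (hj : j.castSucc ∈ M ↔ j'.castSucc ∈ M)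
    (e : t.creasePos j = t.creasePos j') : s.creasePos j = s.creasePos j' := by
  by_cases hm : j.castSucc ∈ M
  · rw [h.creasePos_of_castSucc_mem hm, h.creasePos_of_castSucc_mem (hj.1 hm)] at e
    linarith
  · rwa [h.creasePos_of_castSucc_notMem hm, h.creasePos_of_castSucc_notMem (mt hj.2 hm)] at e

/-- The reflection fixes `x`, so a crease found there after the fold was there before, moved or not.
-/
theorem creasePos_eq_of_mem_hinges {j j' : Fin n} (hj : j ∈ hinges M)
    (e : t.creasePos j = t.creasePos j') : s.creasePos j = s.creasePos j' := by
  rw [h.creasePos_of_mem_hinges hj] at e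
  rw [(h.hinge_pos j hj).1]
  by_cases hm : j'.castSucc ∈ M
  · rw [h.creasePos_of_castSucc_mem hm] at e
    linarith
  · rwa [h.creasePos_of_castSucc_notMem hm] at e

/-- At a hinge, a segment through `x` is unmoved and overlapped the moved layer before the fold, so
it lay on the inner side of that layer's old height; the folded hinge occupies only heights from
there outwards. Other creases are moved or left as a whole, and moved and unmoved layers end up
separated. -/
theorem not_through (hs : s.IsPartialFolding) (j : Fin n) (k : Fin (n + 1)) (hj : t.Folded j)
    (hx : t.creasePos j ∈ t.interiorImage k) : ¬ t.Between j k := by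
  by_cases hh : j ∈ hinges M
  · obtain ⟨a, ha, b, hb, -, -, l2, hax, hbt⟩ := h.exists_of_mem_hinges hs hh
    rw [h.creasePos_of_mem_hinges hh] at hx
    have hk := h.notMem_of_mem_interiorImage hx
    have ov := overlap_of_hinge hax (h.mem_interiorImage_of_notMem hk hx)
    have lk := h.layer_unmoved k hk
    rw [hbt]
    rcases h.outermost with ⟨o, o'⟩ | ⟨o, o'⟩ <;> have := o a ha k hk ov <;>
      have := o' a ha k hk <;> have := o' a ha b hb <;> omega
  · have mi := castSucc_mem_iff hh
    have fs := (h.folded_iff_of_iff mi).1 hj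
    by_cases hm : j.castSucc ∈ M <;> by_cases hk : k ∈ M
    · rw [h.between_of_mem hm (mi.1 hm) hk]
      refine hs.not_through j k fs (h.mem_interiorImage_of_mem hk ?_)
      rwa [← h.creasePos_of_castSucc_mem hm]
    · exact h.not_between_of_mem hm (mi.1 hm) hk
    · exact h.not_between_of_notMem hm (mt mi.2 hm) hk
    · rw [h.between_of_notMem hm (mt mi.2 hm) hk]
      refine hs.not_through j k fs (h.mem_interiorImage_of_notMem hk ?_)
      rwa [← h.creasePos_of_castSucc_notMem hm]

theorem not_through_unfolded (hs : s.IsPartialFolding) (j j' : Fin n) (hj : t.Folded j)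
    (hj' : ¬ t.Folded j') (e : t.creasePos j = t.creasePos j') :
    ¬ t.Between j j'.castSucc := by
  have hh' : j' ∉ hinges M := fun hh' => hj' (h.folded_of_mem_hinges hh')
  have mi' := castSucc_mem_iff hh'
  have fs' := mt (h.folded_iff_of_iff mi').2 hj'
  by_cases hh : j ∈ hinges M
  · obtain ⟨a, ha, b, hb, -, -, l2, hax, hbt⟩ := h.exists_of_mem_hinges hs hh
    have ex := h.creasePos_eq_of_mem_hinges hh e
    rw [(h.hinge_pos j hh).1] at ex
    -- Unfolded paper continues through `x` on both sides, whereas the moved paper is on one side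
    -- only.
    have hm : j'.castSucc ∉ M := by
      intro hm
      rw [folded_iff] at fs'
      unfold creasePos at ex
      have n1 := s.pos_ne j'.castSucc
      have n2 := s.pos_ne j'.succ
      rw [show j'.succ.castSucc = j'.castSucc.succ from rfl, ← ex] at n2
      rw [← ex] at fs' n1
      push Not at fs'
      rcases h.one_side with o | o
      · have o1 := (o _ hm).1
        have o2 := (o _ (mi'.1 hm)).2
        exact n2.symm (le_antisymm (fs'.2 (lt_of_le_of_ne o1 n1.symm)) o2)
      · have o1 := (o _ hm).1
        have o2 := (o _ (mi'.1 hm)).2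
        exact n2 (le_antisymm (fs'.1 (lt_of_le_of_ne o1 n1)) o2)
    have hm' := mt mi'.2 hm
    have e1 := h.layer_unmoved _ hm
    have e2 := hs.layer_eq j' fs'
    rw [hbt]
    rcases h.overlap_of_hinge_of_not_folded ha hax fs' ex.symm with ov | ov <;>
      rcases h.outermost with ⟨o, o'⟩ | ⟨o, o'⟩
    · have := o a ha _ hm ov
      have := o' a ha _ hm
      omega
    · have := o a ha _ hm ov
      have := o' a ha _ hm
      omega
    · have := o a ha _ hm' ov
      have := o' a ha _ hm
      omega
    · have := o a ha _ hm' ov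
      have := o' a ha _ hm
      omega
  · have mi := castSucc_mem_iff hh
    have fs := (h.folded_iff_of_iff mi).1 hj
    by_cases hm : j.castSucc ∈ M <;> by_cases hk : j'.castSucc ∈ M
    · rw [h.between_of_mem hm (mi.1 hm) hk]
      exact hs.not_through_unfolded j j' fs fs' (h.creasePos_eq_of_iff (by tauto) e)
    · exact h.not_between_of_mem hm (mi.1 hm) hk
    · exact h.not_between_of_notMem hm (mt mi.2 hm) hk
    · rw [h.between_of_notMem hm (mt mi.2 hm) hk]
      exact hs.not_through_unfolded j j' fs fs' (h.creasePos_eq_of_iff (by tauto) e)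

/-- Two hinges become nested because the moved layers are reversed. A hinge and another folded
crease are compatible because the latter did not straddle the former while it was unfolded. -/
theorem not_interleaved (hs : s.IsPartialFolding) (j j' : Fin n) (hj : t.Folded j)
    (hj' : t.Folded j') (e : t.creasePos j = t.creasePos j')
    (ho : t.Overlap j.castSucc j'.castSucc) :
    t.Between j j'.castSucc ↔ t.Between j j'.succ := by
  obtain ⟨c, hc⟩ := h.layer_moved
  by_cases hh : j ∈ hinges M <;> by_cases hh' : j' ∈ hinges M
  · obtain ⟨a, ha, b, hb, hab, l1, l2, -, hbt⟩ := h.exists_of_mem_hinges hs hh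
    obtain ⟨a', ha', b', hb', hab', l1', l2', -, -⟩ := h.exists_of_mem_hinges hs hh'
    have key : t.Between j a' ↔ t.Between j b' := by
      rw [hbt, hbt]
      have e1 := hc a ha
      have e2 := hc a' ha'
      rcases h.outermost with ⟨-, o⟩ | ⟨-, o⟩ <;> have := o a ha b hb <;> have := o a ha b' hb' <;>
        have := o a' ha' b hb <;> have := o a' ha' b' hb' <;> omega
    rcases hab' with ⟨rfl, rfl⟩ | ⟨rfl, rfl⟩
    exacts [key, key.symm]
  · have mi := castSucc_mem_iff hh'
    obtain ⟨a, ha, b, hb, hab, l1, l2, -, hbt⟩ := h.exists_of_mem_hinges hs hh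
    have fs' := (h.folded_iff_of_iff mi).1 hj'
    obtain ⟨o1, o2, o3⟩ := ho.of_folded hj hj' e
    have hne : j ≠ j' := fun e => hh' (e ▸ hh)
    have ov : ∀ k, (k = j'.castSucc ∨ k = j'.succ) → t.layer a ≠ t.layer k ∧
        t.layer b ≠ t.layer k := by
      intro k hk
      have na := segment_ne_of_creasePos_eq hne e (a := a) (by tauto) hk
      have nb := segment_ne_of_creasePos_eq hne e (a := b) (by tauto) hk
      refine ⟨h.layered hs _ _ na ?_, h.layered hs _ _ nb ?_⟩ <;> rcases hk with rfl | rfl <;>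
        rcases hab with ⟨rfl, rfl⟩ | ⟨rfl, rfl⟩ <;> assumption
    have d1 := ov _ (.inl rfl)
    have d2 := ov _ (.inr rfl)
    have nb := hs.not_through_unfolded j' j fs' (h.hinge_pos j hh).2
      (h.creasePos_eq_of_mem_hinges hh e).symm
    rw [between_iff] at nb
    rw [hbt, hbt]
    by_cases hm : j'.castSucc ∈ M
    · have hm' := mi.1 hm
      have e1 := hc a ha
      have e2 := hc _ hm
      have e3 := hc _ hm'
      rcases h.outermost with ⟨-, o⟩ | ⟨-, o⟩ <;> have := o _ hm b hb <;> have := o _ hm' b hb <;>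
        have := o a ha b hb <;> omega
    · have hm' := mt mi.2 hm
      have e2 := h.layer_unmoved _ hm
      have e3 := h.layer_unmoved _ hm'
      rcases h.outermost with ⟨-, o⟩ | ⟨-, o⟩ <;> have := o a ha _ hm <;> have := o a ha _ hm' <;>
        have := o a ha b hb <;> omega
  · have mi := castSucc_mem_iff hh
    have fs := (h.folded_iff_of_iff mi).1 hj
    have nb := hs.not_through_unfolded j j' fs (h.hinge_pos j' hh').2
      (h.creasePos_eq_of_mem_hinges hh' e.symm).symm
    have le := hs.layer_eq j' (h.hinge_pos j' hh').2
    have nb' : ¬ s.Between j j'.succ := by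
      rw [between_iff] at nb ⊢
      omega
    have : ∀ k, ¬ s.Between j k → ¬ t.Between j k := by
      intro k hk
      by_cases hm : j.castSucc ∈ M <;> by_cases hkM : k ∈ M
      · rwa [h.between_of_mem hm (mi.1 hm) hkM]
      · exact h.not_between_of_mem hm (mi.1 hm) hkM
      · exact h.not_between_of_notMem hm (mt mi.2 hm) hkM
      · rwa [h.between_of_notMem hm (mt mi.2 hm) hkM]
    exact iff_of_false (this _ nb) (this _ nb')
  · have mi := castSucc_mem_iff hh
    have fs := (h.folded_iff_of_iff mi).1 hj
    have mi' := castSucc_mem_iff hh'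
    have fs' := (h.folded_iff_of_iff mi').1 hj'
    by_cases hm : j.castSucc ∈ M <;> by_cases hk : j'.castSucc ∈ M
    · rw [h.between_of_mem hm (mi.1 hm) hk, h.between_of_mem hm (mi.1 hm) (mi'.1 hk)]
      exact hs.not_interleaved j j' fs fs' (h.creasePos_eq_of_iff (by tauto) e)
        (h.overlap_of_mem hm hk ho)
    · exact iff_of_false (h.not_between_of_mem hm (mi.1 hm) hk)
        (h.not_between_of_mem hm (mi.1 hm) (mt mi'.2 hk))
    · exact iff_of_false (h.not_between_of_notMem hm (mt mi.2 hm) hk)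
        (h.not_between_of_notMem hm (mt mi.2 hm) (mi'.1 hk))
    · rw [h.between_of_notMem hm (mt mi.2 hm) hk,
        h.between_of_notMem hm (mt mi.2 hm) (mt mi'.2 hk)]
      exact hs.not_interleaved j j' fs fs' (h.creasePos_eq_of_iff (by tauto) e)
        (h.overlap_of_notMem hm hk ho)

theorem respects (hs : s.IsPartialFolding) (j : Fin n) (hj : t.Folded j) : t.Respects j := by
  by_cases hh : j ∈ hinges M
  · exact h.hinge_respects j hh
  · have mi := castSucc_mem_iff hh
    have r := hs.respects j ((h.folded_iff_of_iff mi).1 hj)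
    obtain ⟨c, hc⟩ := h.layer_moved
    unfold Respects IsValley IsMountain at *
    by_cases hm : j.castSucc ∈ M
    · rw [h.faceUp_of_mem hm, hc _ hm, hc _ (mi.1 hm), sub_lt_sub_iff_left, sub_lt_sub_iff_left,
        not_not]
      split <;> rename_i e <;> simp only [e] at r <;> exact r.symm
    · rwa [h.faceUp_of_notMem hm, h.layer_unmoved _ hm, h.layer_unmoved _ (mt mi.2 hm)]

theorem isPartialFolding (hs : s.IsPartialFolding) : t.IsPartialFolding where
  layer_eq j hj := by
    have hh : j ∉ hinges M := fun hh => hj (h.folded_of_mem_hinges hh)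
    have mi := castSucc_mem_iff hh
    have e := hs.layer_eq j (mt (h.folded_iff_of_iff mi).2 hj)
    obtain ⟨c, hc⟩ := h.layer_moved
    by_cases hm : j.castSucc ∈ M
    · rw [hc _ hm, hc _ (mi.1 hm), e]
    · rw [h.layer_unmoved _ hm, h.layer_unmoved _ (mt mi.2 hm), e]
  respects := h.respects hs
  layered := h.layered hs
  not_through := h.not_through hs
  not_through_unfolded := h.not_through_unfolded hs
  not_interleaved := h.not_interleaved hs

end IsFoldAt
end Placement

theorem FoldableBySomeLayersFolds.flatFoldable {n : ℕ} {P : CreasePattern n}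
    (h : P.FoldableBySomeLayersFolds) : P.FlatFoldable := by
  obtain ⟨s, hs, hf⟩ := h
  have key : s.IsPartialFolding := by
    clear hf
    induction hs with
    | refl => exact Placement.isPartialFolding_unfolded P
    | tail _ h ih =>
      obtain ⟨k, -, x, M, h, -⟩ := h
      exact h.isPartialFolding ih
  exact ⟨s, hf, fun j => key.respects j (hf j), key.layered, fun j k => key.not_through j k (hf j),
    fun j j' => key.not_interleaved j j' (hf j) (hf j')⟩

end CreasePattern

namespace CreasePattern
namespace Placement

/-! ### Performing simple folds -/

variable {n : ℕ} {P : CreasePattern n}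

open Classical in
-- Moved and unmoved segments share only vertices at `x`, which the reflection fixes; this keeps the
-- placement continuous.
theorem exists_reflection (s : P.Placement) (x : ℝ) (M : Set (Fin (n + 1)))
    (hM : ∀ j ∈ hinges M, s.creasePos j = x) (l : Fin (n + 1) → ℤ) : ∃ t : P.Placement,
      (∀ i ∈ M, t.pos i.castSucc = 2 * x - s.pos i.castSucc ∧ t.pos i.succ = 2 * x - s.pos i.succ) ∧
      (∀ i ∉ M, t.pos i.castSucc = s.pos i.castSucc ∧ t.pos i.succ = s.pos i.succ) ∧
      t.layer = l := by
  let pos : Fin (n + 2) → ℝ := fun v =>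
    if ∃ i ∈ M, v = i.castSucc ∨ v = i.succ then 2 * x - s.pos v else s.pos v
  have hinge : ∀ i ∉ M, ∀ i' ∈ M, (i'.succ = i.castSucc → s.pos i.castSucc = x) ∧
      (i.succ = i'.castSucc → s.pos i.succ = x) := by
    intro i hi i' hi'
    constructor
    · intro e
      have e' : (i' : ℕ) + 1 = i := congrArg Fin.val e
      have es : (⟨i', by omega⟩ : Fin n).succ = i := Fin.ext e'
      have := hM ⟨i', by omega⟩ (.inl ⟨hi', es ▸ hi⟩)
      rw [← e]
      exact this
    · intro e
      have e' : (i : ℕ) + 1 = i' := congrArg Fin.val e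
      have es : (⟨i, by omega⟩ : Fin n).succ = i' := Fin.ext e'
      exact hM ⟨i, by omega⟩ (.inr ⟨es ▸ hi', hi⟩)
  have moved : ∀ i ∈ M, pos i.castSucc = 2 * x - s.pos i.castSucc ∧
      pos i.succ = 2 * x - s.pos i.succ := fun i hi =>
    ⟨if_pos ⟨i, hi, .inl rfl⟩, if_pos ⟨i, hi, .inr rfl⟩⟩
  have unmoved : ∀ i ∉ M, pos i.castSucc = s.pos i.castSucc ∧ pos i.succ = s.pos i.succ := by
    intro i hi
    constructor
    · by_cases h : ∃ i' ∈ M, i.castSucc = i'.castSucc ∨ i.castSucc = i'.succ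
      · refine (if_pos h).trans ?_
        obtain ⟨i', hi', e | e⟩ := h
        · exact absurd (Fin.castSucc_injective _ e ▸ hi') hi
        · rw [(hinge i hi i' hi').1 e.symm]; ring
      · exact if_neg h
    · by_cases h : ∃ i' ∈ M, i.succ = i'.castSucc ∨ i.succ = i'.succ
      · refine (if_pos h).trans ?_
        obtain ⟨i', hi', e | e⟩ := h
        · rw [(hinge i hi i' hi').2 e]; ring
        · exact absurd (Fin.succ_injective _ e ▸ hi') hi
      · exact if_neg h
  refine ⟨⟨pos, fun i => ?_, l⟩, moved, unmoved, rfl⟩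
  rw [← s.isometry i]
  by_cases hi : i ∈ M
  · rw [(moved i hi).1, (moved i hi).2, sub_sub_sub_cancel_left, abs_sub_comm]
  · rw [(unmoved i hi).1, (unmoved i hi).2]

/-- A part of the paper that is on top (`ε = 1`) or at the bottom (`ε = -1`) can be folded at
unfolded creases, apart from the orientation of these creases. -/
theorem exists_fold (s : P.Placement) (x : ℝ) (M : Set (Fin (n + 1))) {ε : ℤ} (hε : ε = 1 ∨ ε = -1)
    (hM : ∀ j ∈ hinges M, s.creasePos j = x ∧ ¬ s.Folded j)
    (one_side : (∀ i ∈ M, x ≤ s.pos i.castSucc ∧ x ≤ s.pos i.succ) ∨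
      (∀ i ∈ M, s.pos i.castSucc ≤ x ∧ s.pos i.succ ≤ x))
    (outer : ∀ i ∈ M, ∀ k ∉ M, s.Overlap i k → ε * s.layer k < ε * s.layer i) :
    ∃ t : P.Placement,
      (∀ i ∈ M, t.FaceUp i ↔ ¬ s.FaceUp i) ∧ (∀ i ∉ M, t.FaceUp i ↔ s.FaceUp i) ∧
      (∀ i ∈ M, ∀ k ∉ M, ε * t.layer k < ε * t.layer i) ∧
      ((∀ j ∈ hinges M, t.Respects j) → s.IsFoldAt t x M) := by
  classical
  obtain ⟨B, hB⟩ : ∃ B : ℤ, ∀ i, |s.layer i| ≤ B :=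
    ⟨∑ i, |s.layer i|, fun i => Finset.single_le_sum (f := fun i => |s.layer i|)
      (fun _ _ => abs_nonneg _) (Finset.mem_univ i)⟩
  have hB : ∀ i, -B ≤ s.layer i ∧ s.layer i ≤ B := fun i => abs_le.1 (hB i)
  -- All heights lie in `[-B, B]`, so the constant `ε * (2 * B + 1)` puts the reversed layers beyond
  -- every unmoved one.
  obtain ⟨t, moved, unmoved, hl⟩ := s.exists_reflection x M (fun j hj => (hM j hj).1)
    fun i => if i ∈ M then ε * (2 * B + 1) - s.layer i else s.layer i
  have lm : ∀ i ∈ M, t.layer i = ε * (2 * B + 1) - s.layer i := fun i hi => by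
    rw [hl]; exact if_pos hi
  have lu : ∀ i ∉ M, t.layer i = s.layer i := fun i hi => by rw [hl]; exact if_neg hi
  have mixed : ∀ i ∈ M, ∀ k ∉ M, ε * t.layer k < ε * t.layer i := by
    intro i hi k hk
    rw [lm i hi, lu k hk]
    have := hB i
    have := hB k
    rcases hε with rfl | rfl <;> omega
  refine ⟨t, ?_, ?_, mixed, fun hr => ⟨hM, hr, one_side, moved, unmoved, ⟨_, lm⟩, lu, ?_⟩⟩
  · intro i hi
    have := s.pos_ne i
    unfold FaceUp
    rw [(moved i hi).1, (moved i hi).2, not_lt]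
    exact ⟨fun h => by linarith, fun h => by have := lt_of_le_of_ne h this.symm; linarith⟩
  · intro i hi
    unfold FaceUp
    rw [(unmoved i hi).1, (unmoved i hi).2]
  · rcases hε with rfl | rfl
    · refine .inl ⟨fun i hi k hk ho => ?_, fun i hi k hk => ?_⟩
      · have := outer i hi k hk ho; omega
      · have := mixed i hi k hk; omega
    · refine .inr ⟨fun i hi k hk ho => ?_, fun i hi k hk => ?_⟩
      · have := outer i hi k hk ho; omega
      · have := mixed i hi k hk; omega

theorem Overlap.symm {s : P.Placement} {i k : Fin (n + 1)} (h : s.Overlap i k) : s.Overlap k i := by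
  unfold Overlap at *
  rwa [Set.inter_comm]

/-! ### Folding a pattern by folding a simpler pattern -/

/-- The segments of `P` are grouped by `φ` to form the segments of `P'`, and the creases of `P'`
are, by `ψ`, the creases of `P` between different groups. -/
structure IsCollapse {n n' : ℕ} (P : CreasePattern n) (P' : CreasePattern n')
    (φ : Fin (n + 1) → Fin (n' + 1)) (ψ : Fin n' → Fin n) : Prop where
  castSucc : ∀ j, φ (ψ j).castSucc = j.castSucc
  succ : ∀ j, φ (ψ j).succ = j.succ
  injective : Function.Injective ψ
  eq : ∀ j ∉ Set.range ψ, φ j.castSucc = φ j.succ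
  label : ∀ j, P.label (ψ j) = P'.label j

/-- In the placement `s` the groups of segments lie as their representatives do in `s'`. -/
structure Simulates {n n' : ℕ} {P : CreasePattern n} {P' : CreasePattern n'}
    (φ : Fin (n + 1) → Fin (n' + 1)) (ψ : Fin n' → Fin n) (s : P.Placement) (s' : P'.Placement) :
    Prop where
  creasePos : ∀ j, s.creasePos (ψ j) = s'.creasePos j
  faceUp_castSucc : ∀ j, s.FaceUp (ψ j).castSucc ↔ s'.FaceUp j.castSucc
  faceUp_succ : ∀ j, s.FaceUp (ψ j).succ ↔ s'.FaceUp j.succ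
  castSucc_mem : ∀ i, s.pos i.castSucc ∈
    Set.uIcc (s'.pos (φ i).castSucc) (s'.pos (φ i).succ)
  succ_mem : ∀ i, s.pos i.succ ∈ Set.uIcc (s'.pos (φ i).castSucc) (s'.pos (φ i).succ)
  layer : ∀ i k, s.Overlap i k → s'.layer (φ i) < s'.layer (φ k) → s.layer i < s.layer k
  folded : ∀ j ∉ Set.range ψ, s.Folded j

section
variable {n' : ℕ} {P' : CreasePattern n'} {φ : Fin (n + 1) → Fin (n' + 1)} {ψ : Fin n' → Fin n}
  {s : P.Placement} {s' t' : P'.Placement}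

theorem Simulates.overlap (h : Simulates φ ψ s s') {i k : Fin (n + 1)} (ho : s.Overlap i k) :
    s'.Overlap (φ i) (φ k) := by
  rw [overlap_iff] at *
  have key : ∀ i, min (s'.pos (φ i).castSucc) (s'.pos (φ i).succ) ≤
      min (s.pos i.castSucc) (s.pos i.succ) ∧ max (s.pos i.castSucc) (s.pos i.succ) ≤
      max (s'.pos (φ i).castSucc) (s'.pos (φ i).succ) := fun i =>
    ⟨le_min (h.castSucc_mem i).1 (h.succ_mem i).1, max_le (h.castSucc_mem i).2 (h.succ_mem i).2⟩
  exact ⟨(key i).1.trans_lt (ho.1.trans_le (key k).2), (key k).1.trans_lt (ho.2.trans_le (key i).2)⟩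

theorem IsCollapse.hinges_preimage (c : IsCollapse P P' φ ψ) (M' : Set (Fin (n' + 1))) :
    hinges (φ ⁻¹' M') = ψ '' hinges M' := by
  ext j
  constructor
  · intro hj
    by_cases hr : j ∈ Set.range ψ
    · obtain ⟨j', rfl⟩ := hr
      refine ⟨j', ?_, rfl⟩
      simpa [hinges, c.castSucc, c.succ] using hj
    · have := c.eq j hr
      simp [hinges, this] at hj
  · rintro ⟨j', hj', rfl⟩
    simpa [hinges, c.castSucc, c.succ] using hj'

/-- Whole groups are moved, so the hinges upstairs correspond one to one to those downstairs and the
fold still has one layer. It is unobstructed since overlaps and their order upstairs are controlled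
by those downstairs. -/
theorem Simulates.exists_oneLayerFold (c : IsCollapse P P' φ ψ) (h : Simulates φ ψ s s')
    (f : s'.OneLayerFold t') : ∃ t, s.OneLayerFold t ∧ Simulates φ ψ t t' := by
  obtain ⟨x, M', f, hcard⟩ := f
  obtain ⟨ε, hε, o1, o2⟩ : ∃ ε : ℤ, (ε = 1 ∨ ε = -1) ∧
      (∀ i ∈ M', ∀ k ∉ M', s'.Overlap i k → ε * s'.layer k < ε * s'.layer i) ∧
      (∀ i ∈ M', ∀ k ∉ M', ε * t'.layer k < ε * t'.layer i) := by
    rcases f.outermost with ⟨a, b⟩ | ⟨a, b⟩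
    · exact ⟨1, .inl rfl, by simpa using a, by simpa using b⟩
    · exact ⟨-1, .inr rfl, by simpa using a, by simpa using b⟩
  have hh := c.hinges_preimage M'
  obtain ⟨t, fm, fu, mixed, fold⟩ := s.exists_fold x (φ ⁻¹' M') hε (by
      rw [hh]
      rintro _ ⟨j, hj, rfl⟩
      obtain ⟨a, b⟩ := f.hinge_pos j hj
      refine ⟨(h.creasePos j).trans a, ?_⟩
      unfold Folded at *
      rwa [h.faceUp_castSucc, h.faceUp_succ]) (by
      refine f.one_side.imp (fun o i hi => ?_) fun o i hi => ?_
      · have := o _ hi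
        exact ⟨(le_min this.1 this.2).trans (h.castSucc_mem i).1,
          (le_min this.1 this.2).trans (h.succ_mem i).1⟩
      · have := o _ hi
        exact ⟨(h.castSucc_mem i).2.trans (max_le this.1 this.2),
          (h.succ_mem i).2.trans (max_le this.1 this.2)⟩) (by
      intro i hi k hk ho
      have := o1 _ hi _ hk (h.overlap ho)
      rcases hε with rfl | rfl
      · have := h.layer k i ho.symm (by omega)
        omega
      · have := h.layer i k ho (by omega)
        omega)
  have fc : ∀ j, t.FaceUp (ψ j).castSucc ↔ t'.FaceUp j.castSucc := by
    intro j
    have e := c.castSucc j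
    by_cases hm : j.castSucc ∈ M'
    · rw [fm _ (by rwa [Set.mem_preimage, e]), f.faceUp_of_mem hm, h.faceUp_castSucc]
    · rw [fu _ (by rwa [Set.mem_preimage, e]), f.faceUp_of_notMem hm, h.faceUp_castSucc]
  have fs : ∀ j, t.FaceUp (ψ j).succ ↔ t'.FaceUp j.succ := by
    intro j
    have e := c.succ j
    by_cases hm : j.succ ∈ M'
    · rw [fm _ (by rwa [Set.mem_preimage, e]), f.faceUp_of_mem hm, h.faceUp_succ]
    · rw [fu _ (by rwa [Set.mem_preimage, e]), f.faceUp_of_notMem hm, h.faceUp_succ]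
  have fold := fold (by
    rw [hh]
    rintro _ ⟨j, hj, rfl⟩
    have r := f.hinge_respects j hj
    have key : (t'.layer j.castSucc < t'.layer j.succ ↔
        t.layer (ψ j).castSucc < t.layer (ψ j).succ) ∧ (t'.layer j.succ < t'.layer j.castSucc ↔
        t.layer (ψ j).succ < t.layer (ψ j).castSucc) := by
      rcases hj with ⟨a, b⟩ | ⟨a, b⟩
      · have e1 := o2 _ a _ b
        have e2 := mixed (ψ j).castSucc (by rwa [Set.mem_preimage, c.castSucc]) (ψ j).succ
          (by rwa [Set.mem_preimage, c.succ])
        rcases hε with rfl | rfl <;> omega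
      · have e1 := o2 _ a _ b
        have e2 := mixed (ψ j).succ (by rwa [Set.mem_preimage, c.succ]) (ψ j).castSucc
          (by rwa [Set.mem_preimage, c.castSucc])
        rcases hε with rfl | rfl <;> omega
    unfold Respects IsValley IsMountain at *
    rwa [c.label, fc, ← key.1, ← key.2])
  refine ⟨t, ⟨x, _, fold, by rw [hh, Set.ncard_image_of_injective _ c.injective, hcard]⟩, ?_, fc, fs,
    ?_, ?_, ?_, ?_⟩
  · intro j
    by_cases hm : j.castSucc ∈ M'
    · rw [f.creasePos_of_castSucc_mem hm, fold.creasePos_of_castSucc_mem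
        (by rwa [Set.mem_preimage, c.castSucc]), h.creasePos]
    · rw [f.creasePos_of_castSucc_notMem hm, fold.creasePos_of_castSucc_notMem
        (by rwa [Set.mem_preimage, c.castSucc]), h.creasePos]
  · intro i
    by_cases hm : φ i ∈ M'
    · rw [(fold.pos_moved i hm).1, (f.pos_moved _ hm).1, (f.pos_moved _ hm).2,
        ← Set.image_const_sub_uIcc]
      exact Set.mem_image_of_mem _ (h.castSucc_mem i)
    · rw [(fold.pos_unmoved i hm).1, (f.pos_unmoved _ hm).1, (f.pos_unmoved _ hm).2]
      exact h.castSucc_mem i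
  · intro i
    by_cases hm : φ i ∈ M'
    · rw [(fold.pos_moved i hm).2, (f.pos_moved _ hm).1, (f.pos_moved _ hm).2,
        ← Set.image_const_sub_uIcc]
      exact Set.mem_image_of_mem _ (h.succ_mem i)
    · rw [(fold.pos_unmoved i hm).2, (f.pos_unmoved _ hm).1, (f.pos_unmoved _ hm).2]
      exact h.succ_mem i
  · intro i k ho hlt
    obtain ⟨d, hd⟩ := fold.layer_moved
    obtain ⟨d', hd'⟩ := f.layer_moved
    by_cases hi : φ i ∈ M' <;> by_cases hk : φ k ∈ M'
    · rw [hd' _ hi, hd' _ hk] at hlt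
      rw [hd _ hi, hd _ hk]
      have := h.layer k i (fold.overlap_of_mem hi hk ho).symm (by omega)
      omega
    · have e1 := o2 _ hi _ hk
      have e2 := mixed _ hi _ hk
      rcases hε with rfl | rfl <;> omega
    · have e1 := o2 _ hk _ hi
      have e2 := mixed _ hk _ hi
      rcases hε with rfl | rfl <;> omega
    · rw [f.layer_unmoved _ hi, f.layer_unmoved _ hk] at hlt
      rw [fold.layer_unmoved _ hi, fold.layer_unmoved _ hk]
      exact h.layer i k (fold.overlap_of_notMem hi hk ho) hlt
  · intro j hj
    exact (fold.folded_iff_of_iff (by rw [Set.mem_preimage, Set.mem_preimage, c.eq j hj])).2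
      (h.folded j hj)

theorem Simulates.foldable (c : IsCollapse P P' φ ψ) (h : Simulates φ ψ s (unfolded P'))
    (r : Relation.ReflTransGen OneLayerFold (unfolded P) s) (hP' : P'.FoldableByOneLayerFolds) :
    P.FoldableByOneLayerFolds := by
  obtain ⟨t', r', hf⟩ := hP'
  have key : ∃ t, Relation.ReflTransGen OneLayerFold (unfolded P) t ∧ Simulates φ ψ t t' := by
    clear hf
    induction r' with
    | refl => exact ⟨s, r, h⟩
    | tail _ f ih =>
      obtain ⟨t, rt, ht⟩ := ih
      obtain ⟨t₂, f₂, h₂⟩ := ht.exists_oneLayerFold c f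
      exact ⟨t₂, rt.tail f₂, h₂⟩
  obtain ⟨t, rt, ht⟩ := key
  refine ⟨t, rt, fun j => ?_⟩
  by_cases hr : j ∈ Set.range ψ
  · obtain ⟨j, rfl⟩ := hr
    have := hf j
    unfold Folded at *
    rwa [ht.faceUp_castSucc, ht.faceUp_succ]
  · exact ht.folded j hr

end
end Placement
end CreasePattern

namespace CreasePattern
open Placement

/-! ### Crimps and end folds by one-layer simple folds -/

variable {n : ℕ}

theorem natExt_vertex_lt (P : CreasePattern n) {a b : ℕ} (hab : a < b) (hb : b ≤ n + 1) :
    natExt P.vertex a < natExt P.vertex b := by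
  rw [natExt_of_lt _ (by omega), natExt_of_lt _ (by omega)]
  exact P.strictMono hab

/-- Truncated subtraction puts segment `0` into the group of segment `1`. -/
theorem leftEndFold_isCollapse (P : CreasePattern (n + 1)) :
    IsCollapse P P.leftEndFold (fun i => ⟨i - 1, by omega⟩) Fin.succ where
  castSucc j := Fin.ext (by simp)
  succ j := Fin.ext (by simp)
  injective := Fin.succ_injective _
  eq j hj := by
    have : j = 0 := by
      by_contra h
      exact hj ⟨j.pred h, Fin.succ_pred j h⟩
    subst this
    rfl
  label _ := rfl

theorem foldableByOneLayerFolds_of_leftEndFold (P : CreasePattern (n + 1))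
    (hl : P.LeftEndFoldable) (h : P.leftEndFold.FoldableByOneLayerFolds) :
    P.FoldableByOneLayerFolds := by
  have hh : hinges ({0} : Set (Fin (n + 2))) = {0} := by
    ext j
    simp only [hinges, Set.mem_ofPred_eq, Set.mem_singleton_iff, Xor, Fin.ext_iff, Fin.val_castSucc,
      Fin.val_succ, Fin.val_zero]
    omega
  -- A valley is folded over the top, a mountain under the bottom.
  obtain ⟨t, fm, fu, mixed, fold⟩ := (unfolded P).exists_fold (P.vertex 1) {0}
    (ε := turnOf (P.label 0)) (by cases P.label 0 <;> simp [turnOf])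
    (by rw [hh]; rintro _ rfl; exact ⟨rfl, not_folded_unfolded P _⟩)
    (.inr (by
      rintro _ rfl
      exact ⟨P.strictMono.monotone (Fin.zero_le _), le_rfl⟩))
    (fun i hi k hk ho => (not_overlap_unfolded P (by rintro rfl; exact hk hi) ho).elim)
  have mixed := mixed 0 rfl 1 (by simp)
  have fold := fold (by
    rw [hh]
    rintro _ rfl
    have f0 : ¬ t.FaceUp (Fin.castSucc 0) := fun h =>
      (fm 0 rfl).1 h (faceUp_unfolded P _)
    unfold Respects IsValley IsMountain
    split <;> rename_i e <;> rw [e] at mixed <;> simp only [turnOf] at mixed <;>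
      refine .inr ⟨f0, ?_⟩
    · change t.layer 1 < t.layer 0; omega
    · change t.layer 0 < t.layer 1; omega)
  refine Simulates.foldable P.leftEndFold_isCollapse (s := t) ?_
    (.single ⟨_, _, fold, by rw [hh, Set.ncard_singleton]⟩) h
  have hs : ∀ j : Fin n, (Fin.succ j).castSucc ∉ ({0} : Set (Fin (n + 2))) := fun j => by
    simp [Fin.ext_iff]
  have hs' : ∀ j : Fin n, (Fin.succ j).succ ∉ ({0} : Set (Fin (n + 2))) := fun j => by
    simp [Fin.ext_iff]
  have v : ∀ i : Fin (n + 2), i ≠ 0 →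
      t.pos i.castSucc = (unfolded P.leftEndFold).pos (Fin.castSucc ⟨i - 1, by omega⟩) ∧
      t.pos i.succ = (unfolded P.leftEndFold).pos (Fin.succ ⟨i - 1, by omega⟩) := by
    intro i hi
    obtain ⟨i, rfl⟩ := Fin.exists_succ_eq.2 hi
    exact fold.pos_unmoved i.succ hi
  have v0 := fold.pos_moved 0 rfl
  have l0 : P.vertex 1 - P.vertex 0 ≤ P.vertex 2 - P.vertex 1 := hl
  have l1 : P.vertex 0 < P.vertex 1 := P.strictMono (by simp)
  have m0 : t.pos (Fin.castSucc 0) ∈ Set.uIcc (P.vertex 1) (P.vertex 2) ∧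
      t.pos (Fin.succ 0) ∈ Set.uIcc (P.vertex 1) (P.vertex 2) := by
    rw [v0.1, v0.2, Set.uIcc_of_le (by linarith)]
    change (2 * P.vertex 1 - P.vertex 0 ∈ _) ∧ (2 * P.vertex 1 - P.vertex 1 ∈ _)
    exact ⟨⟨by linarith, by linarith⟩, by linarith, by linarith⟩
  refine ⟨fun j => ?_, fun j => ?_, fun j => ?_, fun i => ?_, fun i => ?_, ?_, fun j hj => ?_⟩
  · rw [fold.creasePos_of_castSucc_notMem (hs j)]; rfl
  · exact iff_of_true ((fu _ (hs j)).2 (faceUp_unfolded P _)) (faceUp_unfolded _ _)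
  · exact iff_of_true ((fu _ (hs' j)).2 (faceUp_unfolded P _)) (faceUp_unfolded _ _)
  · by_cases hi : i = 0
    · subst hi
      exact m0.1
    · rw [(v i hi).1]
      exact Set.left_mem_uIcc
  · by_cases hi : i = 0
    · subst hi
      exact m0.2
    · rw [(v i hi).2]
      exact Set.right_mem_uIcc
  -- All layers of the unfolded smaller pattern have equal height, so no order is prescribed.
  · exact fun _ _ _ h => (lt_irrefl _ h).elim
  · refine fold.folded_of_mem_hinges (hh ▸ ?_)
    by_contra h
    exact hj ⟨j.pred h, Fin.succ_pred j h⟩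

theorem rightEndFold_isCollapse (P : CreasePattern (n + 1)) :
    IsCollapse P P.rightEndFold (fun i => ⟨min i n, by omega⟩) Fin.castSucc where
  castSucc j := Fin.ext (by simp)
  succ j := Fin.ext (by simp)
  injective := Fin.castSucc_injective _
  eq j hj := by
    have : j = Fin.last n := by
      by_contra h
      exact hj ⟨j.castPred h, Fin.castSucc_castPred j h⟩
    subst this
    simp
  label _ := rfl

theorem foldableByOneLayerFolds_of_rightEndFold (P : CreasePattern (n + 1))
    (hl : P.RightEndFoldable) (h : P.rightEndFold.FoldableByOneLayerFolds) :
    P.FoldableByOneLayerFolds := by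
  have hh : hinges ({Fin.last (n + 1)} : Set (Fin (n + 2))) = {Fin.last n} := by
    ext j
    simp [hinges, Xor, Fin.ext_iff]
    omega
  obtain ⟨t, fm, fu, mixed, fold⟩ := (unfolded P).exists_fold
    (P.vertex (Fin.last (n + 1)).castSucc) {Fin.last (n + 1)}
    (ε := turnOf (P.label (Fin.last n))) (by cases P.label (Fin.last n) <;> simp [turnOf])
    (by rw [hh]; rintro _ rfl; exact ⟨rfl, not_folded_unfolded P _⟩)
    (.inl (by
      rintro _ rfl
      exact ⟨le_rfl, P.strictMono.monotone (Fin.castSucc_lt_succ).le⟩))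
    (fun i hi k hk ho => (not_overlap_unfolded P (by rintro rfl; exact hk hi) ho).elim)
  have hne : (Fin.last n).castSucc ∉ ({Fin.last (n + 1)} : Set (Fin (n + 2))) := by
    simp [Fin.ext_iff]
  have mixed := mixed (Fin.last (n + 1)) rfl (Fin.last n).castSucc hne
  have fold := fold (by
    rw [hh]
    rintro _ rfl
    have f0 : t.FaceUp (Fin.castSucc (Fin.last n)) :=
      (fu _ hne).2 (faceUp_unfolded P _)
    unfold Respects IsValley IsMountain
    split <;> rename_i e <;> rw [e] at mixed <;> simp only [turnOf] at mixed <;>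
      refine .inl ⟨f0, ?_⟩
    · change _ < t.layer (Fin.last (n + 1)); omega
    · change t.layer (Fin.last (n + 1)) < _; omega)
  refine Simulates.foldable P.rightEndFold_isCollapse (s := t) ?_
    (.single ⟨_, _, fold, by rw [hh, Set.ncard_singleton]⟩) h
  have hs : ∀ j : Fin n, (Fin.castSucc j).castSucc ∉ ({Fin.last (n + 1)} : Set (Fin (n + 2))) :=
    fun j => by simp [Fin.ext_iff]; omega
  have hs' : ∀ j : Fin n, (Fin.castSucc j).succ ∉ ({Fin.last (n + 1)} : Set (Fin (n + 2))) :=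
    fun j => by simp [Fin.ext_iff]; omega
  have v : ∀ i : Fin (n + 2), i ≠ Fin.last (n + 1) →
      t.pos i.castSucc = (unfolded P.rightEndFold).pos (Fin.castSucc ⟨min i n, by omega⟩) ∧
      t.pos i.succ = (unfolded P.rightEndFold).pos (Fin.succ ⟨min i n, by omega⟩) := by
    intro i hi
    obtain ⟨i, rfl⟩ := Fin.exists_castSucc_eq.2 hi
    have e : (⟨min i.castSucc n, by omega⟩ : Fin (n + 1)) = i := Fin.ext (by simp; omega)
    rw [e]
    exact fold.pos_unmoved i.castSucc hi
  have v0 := fold.pos_moved _ rfl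
  have e : (⟨min (Fin.last (n + 1)) n, by omega⟩ : Fin (n + 1)) = Fin.last n := Fin.ext (by simp)
  have l0 : P.vertex (Fin.last (n + 1)).succ - P.vertex (Fin.last (n + 1)).castSucc ≤
    P.vertex (Fin.last n).castSucc.succ - P.vertex (Fin.last n).castSucc.castSucc := hl
  have l1 : P.vertex (Fin.last (n + 1)).castSucc < P.vertex (Fin.last (n + 1)).succ :=
    P.strictMono Fin.castSucc_lt_succ
  have l2 : P.vertex (Fin.last n).castSucc.succ = P.vertex (Fin.last (n + 1)).castSucc := rfl
  have m0 : t.pos (Fin.last (n + 1)).castSucc ∈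
        Set.uIcc (P.vertex (Fin.last n).castSucc.castSucc) (P.vertex (Fin.last n).castSucc.succ) ∧
      t.pos (Fin.last (n + 1)).succ ∈
        Set.uIcc (P.vertex (Fin.last n).castSucc.castSucc) (P.vertex (Fin.last n).castSucc.succ) := by
    rw [v0.1, v0.2, Set.uIcc_of_le (by linarith), l2]
    simp only [unfolded, Set.mem_Icc]
    exact ⟨⟨by linarith, by linarith⟩, by linarith, by linarith⟩
  refine ⟨fun j => ?_, fun j => ?_, fun j => ?_, fun i => ?_, fun i => ?_, ?_, fun j hj => ?_⟩
  · rw [fold.creasePos_of_castSucc_notMem (hs j)]; rfl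
  · exact iff_of_true ((fu _ (hs j)).2 (faceUp_unfolded P _)) (faceUp_unfolded _ _)
  · exact iff_of_true ((fu _ (hs' j)).2 (faceUp_unfolded P _)) (faceUp_unfolded _ _)
  · by_cases hi : i = Fin.last (n + 1)
    · subst hi
      rw [e]
      exact m0.1
    · rw [(v i hi).1]
      exact Set.left_mem_uIcc
  · by_cases hi : i = Fin.last (n + 1)
    · subst hi
      rw [e]
      exact m0.2
    · rw [(v i hi).2]
      exact Set.right_mem_uIcc
  · exact fun _ _ _ h => (lt_irrefl _ h).elim
  · refine fold.folded_of_mem_hinges (hh ▸ ?_)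
    by_contra h
    exact hj ⟨j.castPred h, Fin.castSucc_castPred j h⟩

theorem eq_or_eq_of_notMem_range_crimp {k : Fin (n + 1)} {j : Fin (n + 2)}
    (hj : j ∉ Set.range fun j : Fin n => if (j : ℕ) < k then j.castAdd 2 else j.addNat 2) :
    (j : ℕ) = k ∨ (j : ℕ) = k + 1 := by
  by_contra hc
  refine hj ?_
  by_cases h1 : (j : ℕ) < k
  · exact ⟨⟨j, by omega⟩, Fin.ext (by simp [h1])⟩
  · refine ⟨⟨j - 2, by omega⟩, Fin.ext ?_⟩
    dsimp only
    rw [if_neg (by omega)]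
    simp
    omega

theorem crimp_isCollapse (P : CreasePattern (n + 2)) (k : Fin (n + 1)) (h : P.Crimpable k) :
    IsCollapse P (P.crimp k h)
      (fun i => ⟨if (i : ℕ) ≤ k then i else max k (i - 2), by split_ifs <;> omega⟩)
      (fun j => if (j : ℕ) < k then j.castAdd 2 else j.addNat 2) where
  castSucc j := Fin.ext (by
    by_cases hj : (j : ℕ) < k <;> simp only [hj, if_true, if_false, Fin.val_castSucc,
      Fin.val_castAdd, Fin.val_addNat] <;> split_ifs <;> omega)
  succ j := Fin.ext (by
    by_cases hj : (j : ℕ) < k <;> simp only [hj, if_true, if_false, Fin.val_succ,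
      Fin.val_castAdd, Fin.val_addNat] <;> split_ifs <;> omega)
  injective := by
    intro a b hab
    have := congrArg Fin.val hab
    ext
    dsimp only at this
    split_ifs at this <;> simp at this <;> omega
  eq j hj := by
    have := eq_or_eq_of_notMem_range_crimp hj
    refine Fin.ext ?_
    dsimp only [Fin.val_castSucc, Fin.val_succ]
    split_ifs <;> omega
  label j := by
    simp only [crimp]
    split_ifs <;> rfl

/-- Everything to the right of crease `k` is folded over, then everything to the right of crease `k
+ 1` is folded back. Both rotations use the same side `ε`: the labels are opposite, but the middle
segment has been turned over. The length conditions keep the three segments within the merged one.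
-/
theorem foldableByOneLayerFolds_of_crimp (P : CreasePattern (n + 2)) (k : Fin (n + 1))
    (hk : P.Crimpable k) (h : (P.crimp k hk).FoldableByOneLayerFolds) :
    P.FoldableByOneLayerFolds := by
  have hhinge : ∀ c : Fin (n + 2), hinges {i : Fin (n + 3) | (c : ℕ) < i} = {c} := by
    intro c
    ext j
    simp [hinges, Xor, Fin.ext_iff]
    omega
  set ε := turnOf (P.label k.castSucc) with hε
  have hε1 : ε = 1 ∨ ε = -1 := by rw [hε]; cases P.label k.castSucc <;> simp [turnOf]
  -- the first fold
  obtain ⟨s, fm, fu, mixed, fold⟩ := (unfolded P).exists_fold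
    (P.vertex k.castSucc.castSucc.succ) {i | ((k.castSucc : Fin (n + 2)) : ℕ) < i} hε1
    (by rw [hhinge]; rintro _ rfl; exact ⟨rfl, not_folded_unfolded P _⟩)
    (.inl (by
      intro i hi
      have hi : (k : ℕ) < i := hi
      exact ⟨P.strictMono.monotone (by simp [Fin.le_def]; omega),
        P.strictMono.monotone (by simp [Fin.le_def]; omega)⟩))
    (fun i hi k hk ho => (not_overlap_unfolded P (by rintro rfl; exact hk hi) ho).elim)
  have fold := fold (by
    rw [hhinge]
    rintro _ rfl
    have m := mixed k.castSucc.succ (by simp) k.castSucc.castSucc (by simp)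
    have f0 : s.FaceUp k.castSucc.castSucc := (fu _ (by simp)).2 (faceUp_unfolded P _)
    unfold Respects IsValley IsMountain
    split <;> rename_i e <;> rw [hε, e] at m <;> simp only [turnOf] at m <;>
      refine .inl ⟨f0, by omega⟩)
  -- the second fold
  have x2 : s.creasePos k.succ =
      2 * P.vertex k.castSucc.castSucc.succ - P.vertex k.succ.castSucc.succ :=
    fold.creasePos_of_castSucc_mem (by simp)
  obtain ⟨t, fm', fu', mixed', fold'⟩ := s.exists_fold
    (s.creasePos k.succ) {i | ((k.succ : Fin (n + 2)) : ℕ) < i} hε1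
    (by
      rw [hhinge]
      rintro _ rfl
      refine ⟨rfl, ?_⟩
      rw [fold.folded_iff_of_iff (by simp)]
      exact not_folded_unfolded P _)
    (.inr (by
      intro i hi
      have hi : (k : ℕ) + 1 < i := hi
      have hi' : i ∈ {i : Fin (n + 3) | ((k.castSucc : Fin (n + 2)) : ℕ) < i} := by
        simp; omega
      rw [x2, (fold.pos_moved i hi').1, (fold.pos_moved i hi').2, sub_le_sub_iff_left,
        sub_le_sub_iff_left]
      exact ⟨P.strictMono.monotone (by simp [Fin.le_def]; omega),
        P.strictMono.monotone (by simp [Fin.le_def]; omega)⟩))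
    (by
      intro i hi l hl ho
      have hi : (k : ℕ) + 1 < i := hi
      have hi' : i ∈ {i : Fin (n + 3) | ((k.castSucc : Fin (n + 2)) : ℕ) < i} := by
        simp; omega
      -- The tail does not overlap the middle segment, and the first fold has put it beyond all the
      -- unmoved paper on the side `ε`.
      by_cases hl' : l ∈ {i : Fin (n + 3) | ((k.castSucc : Fin (n + 2)) : ℕ) < i}
      · exact (not_overlap_unfolded P (by rintro rfl; exact hl hi) (fold.overlap_of_mem hi' hl' ho)).elim
      · exact mixed i hi' l hl')
  have fold' := fold' (by
    rw [hhinge]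
    rintro _ rfl
    have m := mixed' k.succ.succ (by simp) k.succ.castSucc (by simp)
    have f0 : ¬ t.FaceUp k.succ.castSucc := by
      rw [fu' _ (by simp), fm _ (by simp), not_not]
      exact faceUp_unfolded P _
    have ne : P.label k.castSucc ≠ P.label k.succ := hk.2.2
    unfold Respects IsValley IsMountain
    split <;> rename_i e <;> rw [e] at ne <;> rw [hε] at m <;> revert m <;>
      generalize P.label k.castSucc = c at ne ⊢ <;> cases c <;> simp only [turnOf] <;> intro m <;>
      first | exact absurd rfl ne | exact .inr ⟨f0, by omega⟩)
  refine Simulates.foldable (P.crimp_isCollapse k hk) (s := t) ?_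
    ((Relation.ReflTransGen.single ⟨_, _, fold, by rw [hhinge, Set.ncard_singleton]⟩).tail
      ⟨_, _, fold', by rw [hhinge, Set.ncard_singleton]⟩) h
  have mem1 : ∀ i : Fin (n + 3), i ∈ {i : Fin (n + 3) | ((k.castSucc : Fin (n + 2)) : ℕ) < i} ↔
    (k : ℕ) < i := fun _ => Iff.rfl
  have mem2 : ∀ i : Fin (n + 3), i ∈ {i : Fin (n + 3) | ((k.succ : Fin (n + 2)) : ℕ) < i} ↔
    (k : ℕ) + 1 < i := fun _ => Iff.rfl
  have V : ∀ v, P.vertex v = natExt P.vertex v := fun v => (natExt_val _ _).symm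
  have V' : ∀ v, (unfolded (P.crimp k hk)).pos v = natExt (P.crimp k hk).vertex v := fun v =>
    (natExt_val _ _).symm
  have b := P.segLen_le_of_crimpable k hk
  have x2' : s.creasePos k.succ = 2 * natExt P.vertex (k + 1) - natExt P.vertex (k + 2) := by
    rw [x2, V, V]; rfl
  have p1 : ∀ i : Fin (n + 3), (i : ℕ) ≤ k →
      t.pos i.castSucc = natExt P.vertex i ∧ t.pos i.succ = natExt P.vertex (i + 1) := by
    intro i hi
    have a := fold.pos_unmoved i (by rw [mem1]; omega)
    have a' := fold'.pos_unmoved i (by rw [mem2]; omega)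
    rw [a'.1, a'.2, a.1, a.2]
    exact ⟨V _, V _⟩
  have p2 : ∀ i : Fin (n + 3), (i : ℕ) = k + 1 → t.pos i.castSucc = natExt P.vertex (k + 1) ∧
      t.pos i.succ = 2 * natExt P.vertex (k + 1) - natExt P.vertex (k + 2) := by
    intro i hi
    have a := fold.pos_moved i (by rw [mem1]; omega)
    have a' := fold'.pos_unmoved i (by rw [mem2]; omega)
    rw [a'.1, a'.2, a.1, a.2]
    simp only [unfolded, V, Fin.val_castSucc, Fin.val_succ, hi]
    exact ⟨by ring, trivial⟩
  have p3 : ∀ i : Fin (n + 3), (k : ℕ) + 1 < i →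
      t.pos i.castSucc = natExt P.vertex i - 2 * P.segLen (k + 1) ∧
      t.pos i.succ = natExt P.vertex (i + 1) - 2 * P.segLen (k + 1) := by
    intro i hi
    have a := fold.pos_moved i (by rw [mem1]; omega)
    have a' := fold'.pos_moved i (by rw [mem2]; omega)
    rw [a'.1, a'.2, a.1, a.2, x2', segLen_eq _ (by omega)]
    simp only [unfolded, V, Fin.val_castSucc, Fin.val_succ]
    exact ⟨by ring, by ring⟩
  have up : ∀ i : Fin (n + 3), (i : ℕ) ≠ k + 1 → t.FaceUp i := by
    intro i hi
    by_cases h1 : (i : ℕ) ≤ k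
    · rw [fu' _ (by rw [mem2]; omega), fu _ (by rw [mem1]; omega)]
      exact faceUp_unfolded P _
    · rw [fm' _ (by rw [mem2]; omega), fm _ (by rw [mem1]; omega), not_not]
      exact faceUp_unfolded P _
  have mem : ∀ i : Fin (n + 3), ∀ l : Fin (n + 1),
      (l : ℕ) = (if (i : ℕ) ≤ k then (i : ℕ) else max (k : ℕ) (i - 2)) →
      t.pos i.castSucc ∈ Set.uIcc ((unfolded (P.crimp k hk)).pos l.castSucc)
        ((unfolded (P.crimp k hk)).pos l.succ) ∧
      t.pos i.succ ∈ Set.uIcc ((unfolded (P.crimp k hk)).pos l.castSucc)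
        ((unfolded (P.crimp k hk)).pos l.succ) := by
    intro i l hl
    rw [V', V', Fin.val_castSucc, Fin.val_succ]
    by_cases hlk : (l : ℕ) = k
    · rw [hlk, P.natExt_vertex_crimp_of_le k hk le_rfl,
        P.natExt_vertex_crimp_of_gt k hk (by omega) (by omega)]
      have c1 := P.natExt_vertex_lt (a := k) (b := k + 1) (by omega) (by omega)
      have c2 := P.natExt_vertex_lt (a := k + 1) (b := k + 2) (by omega) (by omega)
      have c3 := P.natExt_vertex_lt (a := k + 2) (b := k + 3) (by omega) (by omega)
      have e3 : natExt P.vertex (k + 1 + 2) = natExt P.vertex (k + 3) := rfl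
      rw [segLen_eq _ (by omega), segLen_eq _ (by omega), segLen_eq _ (by omega)] at b
      have e1 : natExt P.vertex (k + 1 + 1) = natExt P.vertex (k + 2) := rfl
      have e2 : natExt P.vertex (k + 2 + 1) = natExt P.vertex (k + 3) := rfl
      rw [e1, e2] at b
      rw [e3, segLen_eq _ (by omega), e1, Set.uIcc_of_le (by linarith)]
      have hi : (i : ℕ) = k ∨ (i : ℕ) = k + 1 ∨ (i : ℕ) = k + 2 := by
        split_ifs at hl <;> omega
      rcases hi with hi | hi | hi
      · rw [(p1 i (by omega)).1, (p1 i (by omega)).2, hi]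
        exact ⟨⟨by linarith, by linarith⟩, by linarith, by linarith⟩
      · rw [(p2 i hi).1, (p2 i hi).2]
        exact ⟨⟨by linarith, by linarith⟩, by linarith, by linarith⟩
      · rw [(p3 i (by omega)).1, (p3 i (by omega)).2, hi, segLen_eq _ (by omega), e1, e2]
        exact ⟨⟨by linarith, by linarith⟩, by linarith, by linarith⟩
    · by_cases hik : (i : ℕ) < k
      · rw [if_pos hik.le] at hl
        rw [hl, P.natExt_vertex_crimp_of_le k hk hik.le,
          P.natExt_vertex_crimp_of_le k hk (Nat.succ_le_of_lt hik), (p1 i hik.le).1, (p1 i hik.le).2]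
        exact ⟨Set.left_mem_uIcc, Set.right_mem_uIcc⟩
      · have hl : (i : ℕ) = l + 2 ∧ (k : ℕ) < l := by split_ifs at hl <;> omega
        rw [P.natExt_vertex_crimp_of_gt k hk hl.2 (by omega),
          P.natExt_vertex_crimp_of_gt k hk (by omega) (by omega), (p3 i (by omega)).1,
          (p3 i (by omega)).2, hl.1]
        exact ⟨Set.left_mem_uIcc, Set.right_mem_uIcc⟩
  refine ⟨fun j => ?_, fun j => ?_, fun j => ?_, fun i => (mem i _ rfl).1, fun i => (mem i _ rfl).2,
    fun _ _ _ h => (lt_irrefl _ h).elim, fun j hj => ?_⟩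
  · change t.pos _ = (unfolded (P.crimp k hk)).pos _
    rw [V']
    by_cases hjk : (j : ℕ) < k
    · rw [if_pos hjk]
      refine (p1 (j.castAdd 2).castSucc (by simp; omega)).2.trans ?_
      simp only [Fin.val_succ, Fin.val_castSucc, Fin.val_castAdd]
      rw [P.natExt_vertex_crimp_of_le k hk (by omega)]
    · rw [if_neg hjk]
      refine (p3 (j.addNat 2).castSucc (by simp; omega)).2.trans ?_
      simp only [Fin.val_succ, Fin.val_castSucc, Fin.val_addNat]
      rw [P.natExt_vertex_crimp_of_gt k hk (by omega) (by omega)]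
  · refine iff_of_true (up _ ?_) (faceUp_unfolded _ _)
    split_ifs <;> simp <;> omega
  · refine iff_of_true (up _ ?_) (faceUp_unfolded _ _)
    split_ifs <;> simp <;> omega
  · have := eq_or_eq_of_notMem_range_crimp hj
    rcases this with e | e
    · have : j = k.castSucc := Fin.ext e
      subst this
      rw [fold'.folded_iff_of_iff (by simp)]
      exact fold.folded_of_mem_hinges (by rw [hhinge]; rfl)
    · have : j = k.succ := Fin.ext e
      subst this
      exact fold'.folded_of_mem_hinges (by rw [hhinge]; rfl)

theorem FoldableByCrimpsAndEndFolds.foldableByOneLayerFolds {P : CreasePattern n}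
    (h : P.FoldableByCrimpsAndEndFolds) : P.FoldableByOneLayerFolds := by
  induction h with
  | done P => exact ⟨_, .refl, fun j => j.elim0⟩
  | crimp P k h _ ih => exact P.foldableByOneLayerFolds_of_crimp k h ih
  | leftEnd P h _ ih => exact P.foldableByOneLayerFolds_of_leftEndFold h ih
  | rightEnd P h _ ih => exact P.foldableByOneLayerFolds_of_rightEndFold h ih

end CreasePattern

/-! ### The cycle of implications -/

theorem mainTheorem1 (n : ℕ) (P : CreasePattern n) :
    List.TFAE [
      P.FoldableByCrimpsAndEndFolds,
      P.FoldableByOneLayerFolds,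
      P.FoldableBySomeLayersFolds,
      P.FlatFoldable,
      ∀ p q : Fin n, P.Suspicious p q → P.Innocent p q] := by
  tfae_have 1 → 2 := fun h => h.foldableByOneLayerFolds
  tfae_have 2 → 3 := fun ⟨s, hs, hf⟩ => ⟨s, Relation.ReflTransGen.mono (fun _ _ h => ⟨1, le_rfl, h⟩) _ _ hs, hf⟩
  tfae_have 3 → 4 := fun h => h.flatFoldable
  tfae_have 4 → 5 := fun h _ _ hpq => h.innocent hpq
  tfae_have 5 → 1 := P.foldableByCrimpsAndEndFolds_of_innocent
  tfae_finish
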